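/- Let $\mathbb{T}$ be an infinite random recursive tree on $\mathbb{N}=\{1,2,\dots\}$: vertex $1$ is the root and, for each $i\ge 2$, the parent of $i$ is uniform on $\{1,\dots,i-1\}$, independently of the other parents. Independently of $\mathbb{T}$, let the edge joining $i$ to its parent be removed at time $\epsilon_i$, where $(\epsilon_i)_{i\ge 2}$ are i.i.d. standard exponential variables. For $t\ge 0$ let $\Pi(t)$ be the partition of $\mathbb{N}$ into the connected components (blocks) that remain after removing all edges with $\epsilon_i\le t$. For every $t\ge 0$, almost surely, every block $B$ of $\Pi(t)$ has a weight $$\lim_{n\to\infty} n^{-e^{-t}}\,\#\{j\le n: j\in B\}\in(0,\infty).$$ Let $X_1(t),X_2(t),\dots$ be the weights of the blocks of $\Pi(t)$ and let $\mathcal{Y}_t=\sum_i\delta_{\ln X_i(t)}$ (one atom per block). Then $\mathcal{Y}=(\mathcal{Y}_t:t\ge 0)$ is an Ornstein–Uhlenbeck branching process, in the following sense. It is a process of random point measures on $\mathbb{R}$, each $\mathcal{Y}_t$ having almost surely only finitely many atoms in $[a,\infty)$ for every $a\in\mathbb{R}$. It is Markovian (with respect to the filtration that it generates), and for all $s,t\ge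 0$ the conditional law of $\mathcal{Y}_{s+t}$ given $\mathcal{Y}_s=\sum_i\delta_{y_i}$ is the law of $$\sum_i\sum_j\delta_{e^{-t}y_i+\zeta^{(i)}_j},$$ where the point measures $\mathcal{Z}^{(i)}=\sum_j\delta_{\zeta^{(i)}_j}$ are independent and each has the same law as $\mathcal{Y}_t$; for each $t$ these laws are given by a (measurable) Markov kernel, the same for all $s$. Furthermore, for every $t\ge 0$, $$\mathbb{E}\left(\int e^{qy}\,\mathcal{Y}_t(dy)\right)=\frac{q-1}{e^{-t}q-1}\,\frac{\Gamma(q)}{\Gamma(e^{-t}q)},\qquad q>e^t,$$ and this formula determines the mean intensity of $\mathcal{Y}_t$: any measure $m$ on $\mathbb{R}$ such that $\int e^{qy}\,m(dy)$ equals the right-hand side for all $q>e^t$ satisfies $m(B)=\mathbb{E}(\mathcal{Y}_t(B))$ for all Borel sets $B$. -/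

import Mathlib

open MeasureTheory ProbabilityTheory Filter Topology
open scoped ENNReal

/-- The randomness of the destruction of an infinite random recursive tree. The vertices are
labelled `1, 2, 3, …`; the vertex with label `i + 1` is represented by `i : ℕ`, so the root is `0`.
`parent k` is the parent of the vertex `k + 1`: it is uniform on the vertices `0, …, k`, independently
of the other parents. `clock k` is the time at which the edge from `k + 1` to its parent is removed:
these times are i.i.d. standard exponential and independent of the tree. -/
structure IsRecursiveTreeWithClocks {Ω : Type*} [MeasurableSpace Ω] (μ : Measure Ω)
    (parent : (k : ℕ) → Ω → Fin (k + 1)) (clock : ℕ → Ω → ℝ) : Prop where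
  measurable_parent : ∀ k, Measurable (parent k)
  measurable_clock : ∀ k, Measurable (clock k)
  parent_uniform : ∀ (k : ℕ) (j : Fin (k + 1)), μ (parent k ⁻¹' {j}) = ((k : ℝ≥0∞) + 1)⁻¹
  clock_exponential : ∀ k, μ.map (clock k) = expMeasure 1
  parent_indep : iIndepFun parent μ
  clock_indep : iIndepFun clock μ
  parent_clock_indep : IndepFun (fun ω k => parent k ω) (fun ω k => clock k ω) μ

/-- The forest that is left at time `t`: the edge between `k + 1` and its parent is still present
if and only if its removal time is larger than `t`. -/
def remainingForest {Ω : Type*} (parent : (k : ℕ) → Ω → Fin (k + 1)) (clock : ℕ → Ω → ℝ)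
    (t : ℝ) (ω : Ω) : SimpleGraph ℕ :=
  SimpleGraph.fromRel fun a b => ∃ k : ℕ, a = k + 1 ∧ b = (parent k ω : ℕ) ∧ t < clock k ω

/-- `n ^ (-e ^ (-t)) * #{vertices of B among the first n vertices}`. -/
noncomputable def scaledCount (t : ℝ) (B : Set ℕ) (n : ℕ) : ℝ :=
  (n : ℝ) ^ (-Real.exp (-t)) * ((B ∩ Set.Iio n).ncard : ℝ)

/-- The weight of a block `B` present at time `t`. -/
noncomputable def blockWeight (t : ℝ) (B : Set ℕ) : ℝ :=
  limUnder atTop (scaledCount t B)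

/-- The point measure with an atom at the logarithm of the weight of each block, where the blocks
at time `t` are the vertex sets of the connected components of the remaining forest. -/
noncomputable def logWeights {Ω : Type*} (parent : (k : ℕ) → Ω → Fin (k + 1)) (clock : ℕ → Ω → ℝ)
    (t : ℝ) (ω : Ω) : Measure ℝ :=
  Measure.sum fun C : (remainingForest parent clock t ω).ConnectedComponent =>
    Measure.dirac (Real.log (blockWeight t C.supp))

/-- The point measure `∑ i, δ_{y i}`. -/
noncomputable def pointMeasure {ι : Type} (y : ι → ℝ) : Measure ℝ :=
  Measure.sum fun i => Measure.dirac (y i)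

/-- Configurations (with multiplicity, possibly finite) with only finitely many atoms above every
level, i.e. those whose atoms can be ranked in decreasing order. -/
def FiniteAbove {ι : Type} (y : ι → ℝ) : Prop :=
  ∀ a : ℝ, {i | a ≤ y i}.Finite

/-- The law of `∑ i, ∑ j, δ_{e^{-t} y i + ζ i j}`, where the point measures `Z i = ∑ j, δ_{ζ i j}`
are independent with common law `P`; the inner sum over `j` is the image of `Z i` under the
translation by `e^{-t} y i`. -/
noncomputable def ouSuperpositionLaw (P : Measure (Measure ℝ)) (t : ℝ) {ι : Type} (y : ι → ℝ) :
    Measure (Measure ℝ) :=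
  (Measure.infinitePi fun _ : ι => P).map fun Z : ι → Measure ℝ =>
    Measure.sum fun i => (Z i).map fun z => Real.exp (-t) * y i + z

/-- The σ-algebra generated by the process `Y` on the time interval `[0, s]`. -/
@[reducible] def pastSigma {Ω : Type*} (Y : ℝ → Ω → Measure ℝ) (s : ℝ) : MeasurableSpace Ω :=
  ⨆ r ∈ Set.Icc 0 s, MeasurableSpace.comap (Y r) inferInstance

/-- `Y = (Y t : t ≥ 0)` is an Ornstein–Uhlenbeck branching process: a Markov process with values in
the point measures on `ℝ` such that, given `Y s = ∑ i, δ_{y i}`, the point measure `Y (s + t)` is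
distributed as `∑ i, ∑ j, δ_{e^{-t} y i + ζ i j}`, where the point measures `∑ j, δ_{ζ i j}` are
independent copies of `Y t`. -/
structure IsOUBranchingProcess {Ω : Type*} [MeasurableSpace Ω] (μ : Measure Ω)
    (Y : ℝ → Ω → Measure ℝ) : Prop where
  measurable : ∀ t, 0 ≤ t → Measurable (Y t)
  point_valued : ∀ t, 0 ≤ t → ∀ᵐ ω ∂μ,
    ∃ (ι : Type) (_ : Countable ι) (y : ι → ℝ), FiniteAbove y ∧ Y t ω = pointMeasure y
  transition : ∀ t, 0 ≤ t → ∃ κ : Kernel (Measure ℝ) (Measure ℝ), IsMarkovKernel κ ∧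
    (∀ (ι : Type) [Countable ι] (y : ι → ℝ), FiniteAbove y →
      κ (pointMeasure y) = ouSuperpositionLaw (μ.map (Y t)) t y) ∧
    ∀ s, 0 ≤ s → ∀ A : Set (Measure ℝ), MeasurableSet A →
      μ[(Y (s + t) ⁻¹' A).indicator (fun _ => (1 : ℝ)) | pastSigma Y s]
        =ᵐ[μ] fun ω => (κ (Y s ω)).real A

/-!
The whole randomness is one random element of the space `MarkedTree` of recursive trees with removal
times, with the product law `treeLaw`; a block is identified with its smallest vertex, its root
(`blockRoot`), and the point measure becomes a function `treeLogWeights t` of the marked tree.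

**Weights and their moments.** Let `N` be the size of the block with root `b` at time `t` among the
first `m` vertices, and `p = e^{-t}`. The next vertex joins this block with probability `p N / m`, so
`risingRatio q N / risingRatio (p q) m` is a martingale for every `q > -1`
(`martingale_blockMartingale`), where `risingRatio q n = Γ(n + q) / (Γ(n) Γ(1 + q))` is of the order
of `n ^ q`. The martingale for `q = 1` gives the existence of the weight, the one for `q = -1/2` its
positivity, and an `L²` bound on the one for `q > 0` gives the `q`-th moment of the weight
(`lintegral_rootWeight_rpow`). Summing over the roots `b ≥ 0`, where the series telescopes, gives the
formula for the mean intensity. Two measures with the same exponential moments of large order are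
equal by analytic continuation of the moment-generating function of a tilted measure
(`measure_ext_of_lintegral_exp`).

**Branching and Markov properties.** The splitting property of random recursive trees is formulated
as an invariance: if, in a tree with law `treeLaw`, the tree carried by each block at time `s` is
replaced by an independent copy of the whole marked tree (`regraft`), the law is unchanged
(`map_regraft`). Indeed, the parent in the new tree is obtained from a uniform vertex by choosing a
vertex uniformly in its block, hence is uniform, and the exponential law is memoryless. Regrafting
changes nothing up to time `s`, and at time `s + t` it turns each block of weight `w` at time `s` into
blocks of weights `w' * w ^ (e^{-t})`, where `w'` runs over the weights at time `t` of the tree grafted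
into it (`rootWeight_regraft`). In logarithmic scale this is the transition of an Ornstein–Uhlenbeck
branching process, and Fubini's theorem gives the Markov property (`treeLaw_inter_preimage`). Ranking
the atoms of a point measure in decreasing order makes the transition law a measurable kernel
(`branchingKernel`).
-/

/-! ### Roots of blocks -/

/-- A recursive tree whose edges carry removal times: `x k` is the pair formed by the parent of the
vertex `k + 1` and the time at which the edge from `k + 1` to this parent is removed. -/
abbrev MarkedTree := (k : ℕ) → Fin (k + 1) × ℝ

/-- The root (that is, the smallest vertex) of the block that contains a given vertex when all the
edges with removal time at most `t` have been removed. -/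
noncomputable def blockRoot (t : ℝ) (x : MarkedTree) : ℕ → ℕ
  | 0 => 0
  | k + 1 => if t < (x k).2 then blockRoot t x (x k).1 else k + 1
  decreasing_by exact (x k).1.2

lemma blockRoot_zero (t : ℝ) (x : MarkedTree) : blockRoot t x 0 = 0 := by
  rw [blockRoot]

lemma blockRoot_succ (t : ℝ) (x : MarkedTree) (k : ℕ) :
    blockRoot t x (k + 1) = if t < (x k).2 then blockRoot t x (x k).1 else k + 1 := by
  rw [blockRoot]

lemma blockRoot_le (t : ℝ) (x : MarkedTree) (v : ℕ) : blockRoot t x v ≤ v := by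
  induction v using Nat.strong_induction_on with
  | _ v ih =>
    cases v with
    | zero => rw [blockRoot_zero]
    | succ k =>
      rw [blockRoot_succ]
      split_ifs
      · exact (ih _ (x k).1.2).trans (x k).1.2.le
      · exact le_rfl

lemma blockRoot_blockRoot (t : ℝ) (x : MarkedTree) (v : ℕ) :
    blockRoot t x (blockRoot t x v) = blockRoot t x v := by
  induction v using Nat.strong_induction_on with
  | _ v ih =>
    cases v with
    | zero => simp [blockRoot_zero]
    | succ k =>
      by_cases h : t < (x k).2
      · rw [blockRoot_succ, if_pos h]
        exact ih _ (x k).1.2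
      · have : blockRoot t x (k + 1) = k + 1 := by rw [blockRoot_succ, if_neg h]
        rw [this, this]

lemma blockRoot_succ_eq_self_iff (t : ℝ) (x : MarkedTree) (k : ℕ) :
    blockRoot t x (k + 1) = k + 1 ↔ (x k).2 ≤ t := by
  rw [blockRoot_succ]
  split_ifs with h
  · have := (blockRoot_le t x (x k).1).trans_lt (x k).1.2
    exact ⟨fun h' => by omega, fun h' => absurd h (not_lt.2 h')⟩
  · exact ⟨fun _ => not_lt.1 h, fun _ => rfl⟩

/-- The root of a vertex depends on the edges below this vertex only. -/
lemma blockRoot_congr {t : ℝ} {x y : MarkedTree} {v : ℕ} (h : ∀ k < v, x k = y k) :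
    blockRoot t x v = blockRoot t y v := by
  induction v using Nat.strong_induction_on with
  | _ v ih =>
    cases v with
    | zero => simp [blockRoot_zero]
    | succ k =>
      rw [blockRoot_succ, blockRoot_succ, ← h k (by omega)]
      split_ifs
      · exact ih _ (x k).1.2 fun j hj => h j (by have := (x k).1.2; omega)
      · rfl

section Components

variable {Ω : Type*} (parent : (k : ℕ) → Ω → Fin (k + 1)) (clock : ℕ → Ω → ℝ) (t : ℝ) (ω : Ω)

/-- The two families of random variables, seen as one random marked tree. -/
def markedTree (ω : Ω) : MarkedTree := fun k => (parent k ω, clock k ω)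

lemma reachable_blockRoot (v : ℕ) : (remainingForest parent clock t ω).Reachable v
    (blockRoot t (markedTree parent clock ω) v) := by
  induction v using Nat.strong_induction_on with
  | _ v ih =>
    cases v with
    | zero => rw [blockRoot_zero]
    | succ k =>
      rw [blockRoot_succ]
      split_ifs with h
      · have hk := (parent k ω).2
        refine SimpleGraph.Reachable.trans (SimpleGraph.Adj.reachable ?_) (ih _ hk)
        rw [remainingForest, SimpleGraph.fromRel_adj]
        exact ⟨by simp only [markedTree]; omega, Or.inl ⟨k, rfl, rfl, h⟩⟩
      · rfl

lemma reachable_iff_blockRoot_eq (u v : ℕ) : (remainingForest parent clock t ω).Reachable u v ↔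
    blockRoot t (markedTree parent clock ω) u = blockRoot t (markedTree parent clock ω) v := by
  constructor
  · rintro ⟨w⟩
    induction w with
    | nil => rfl
    | @cons a b c hab _ ih =>
      rw [← ih]
      rw [remainingForest, SimpleGraph.fromRel_adj] at hab
      obtain ⟨-, ⟨k, rfl, rfl, hk⟩ | ⟨k, rfl, rfl, hk⟩⟩ := hab
      · exact (blockRoot_succ t (markedTree parent clock ω) k).trans (if_pos hk)
      · exact ((blockRoot_succ t (markedTree parent clock ω) k).trans (if_pos hk)).symm
  · intro h
    refine (reachable_blockRoot parent clock t ω u).trans ?_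
    rw [h]
    exact (reachable_blockRoot parent clock t ω v).symm

/-- Every block contains exactly one vertex that is the root of its block. -/
noncomputable def rootEquivComponent :
    {b : ℕ // blockRoot t (markedTree parent clock ω) b = b} ≃
      (remainingForest parent clock t ω).ConnectedComponent :=
  Equiv.ofBijective (fun b => (remainingForest parent clock t ω).connectedComponentMk b) <| by
    constructor
    · intro b c hbc
      have := (reachable_iff_blockRoot_eq parent clock t ω b c).1
        (SimpleGraph.ConnectedComponent.exact hbc)
      rw [b.2, c.2] at this
      exact Subtype.ext this
    · intro C
      induction C using SimpleGraph.ConnectedComponent.ind with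
      | _ v =>
        exact ⟨⟨_, blockRoot_blockRoot t _ v⟩, SimpleGraph.ConnectedComponent.sound
          (reachable_blockRoot parent clock t ω v).symm⟩

lemma supp_rootEquivComponent (b : {b : ℕ // blockRoot t (markedTree parent clock ω) b = b}) :
    (rootEquivComponent parent clock t ω b).supp =
      {v | blockRoot t (markedTree parent clock ω) v = b} := by
  ext v
  rw [SimpleGraph.ConnectedComponent.mem_supp_iff, Set.mem_ofPred_eq]
  change (remainingForest parent clock t ω).connectedComponentMk v =
    (remainingForest parent clock t ω).connectedComponentMk b ↔ _
  rw [SimpleGraph.ConnectedComponent.eq, reachable_iff_blockRoot_eq, b.2]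

end Components

/-- The weight of the block with root `b` at time `t`. -/
noncomputable def rootWeight (t : ℝ) (x : MarkedTree) (b : ℕ) : ℝ :=
  blockWeight t {v | blockRoot t x v = b}

/-- The point measure of the logarithms of the weights of the blocks at time `t`, as a function of
the marked tree. Blocks are indexed by their roots. -/
noncomputable def treeLogWeights (t : ℝ) (x : MarkedTree) : Measure ℝ :=
  Measure.sum fun b : {b : ℕ // blockRoot t x b = b} => Measure.dirac (Real.log (rootWeight t x b))

lemma logWeights_eq_treeLogWeights {Ω : Type*} (parent : (k : ℕ) → Ω → Fin (k + 1))
    (clock : ℕ → Ω → ℝ) (t : ℝ) (ω : Ω) :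
    logWeights parent clock t ω = treeLogWeights t (markedTree parent clock ω) := by
  rw [logWeights, treeLogWeights, ← Measure.sum_comp_equiv (rootEquivComponent parent clock t ω)]
  simp only [Function.comp_def, supp_rootEquivComponent]
  rfl

/-! ### The law of the marked tree -/

instance : IsProbabilityMeasure (expMeasure 1) := isProbabilityMeasure_expMeasure one_pos

lemma expMeasure_Iic {t : ℝ} (ht : 0 ≤ t) :
    expMeasure 1 (Set.Iic t) = ENNReal.ofReal (1 - Real.exp (-t)) := by
  rw [← ofReal_cdf, cdf_expMeasure_eq one_pos, if_pos ht, one_mul]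

lemma expMeasure_Ioi {t : ℝ} (ht : 0 ≤ t) :
    expMeasure 1 (Set.Ioi t) = ENNReal.ofReal (Real.exp (-t)) := by
  rw [← Set.compl_Iic, prob_compl_eq_one_sub measurableSet_Iic, expMeasure_Iic ht,
    ← ENNReal.ofReal_one, ← ENNReal.ofReal_sub _ (by simpa using ht)]
  congr 1
  ring

/-- The exponential distribution is memoryless. -/
lemma expMeasure_restrict_Ioi {s : ℝ} (hs : 0 ≤ s) :
    (expMeasure 1).restrict (Set.Ioi s) =
      ENNReal.ofReal (Real.exp (-s)) • (expMeasure 1).map (fun e => s + e) := by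
  refine Measure.ext_of_Iic _ _ fun a => ?_
  rw [Measure.restrict_apply measurableSet_Iic, Measure.smul_apply,
    Measure.map_apply (by fun_prop) measurableSet_Iic, smul_eq_mul]
  have h1 : Set.Iic a ∩ Set.Ioi s = Set.Ioc s a := by
    ext x
    simp [and_comm]
  have h2 : (fun e => s + e) ⁻¹' Set.Iic a = Set.Iic (a - s) := by
    ext x
    simp [le_sub_iff_add_le']
  rw [h1, h2]
  rcases le_or_gt s a with h | h
  · rw [expMeasure_Iic (sub_nonneg.2 h), ← ENNReal.ofReal_mul (Real.exp_pos _).le]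
    conv_lhs => rw [← measure_cdf (expMeasure 1)]
    rw [StieltjesFunction.measure_Ioc, cdf_expMeasure_eq one_pos, cdf_expMeasure_eq one_pos,
      if_pos hs, if_pos (hs.trans h), mul_sub, ← Real.exp_add]
    congr 1
    ring_nf
  · rw [Set.Ioc_eq_empty (by simpa using h.le), measure_empty, ← ofReal_cdf,
      cdf_expMeasure_eq one_pos, if_neg (by simpa using h)]
    simp

/-- The law of the parent of the vertex `k + 1` and of the removal time of the edge above it. -/
noncomputable def edgeLaw (k : ℕ) : Measure (Fin (k + 1) × ℝ) :=
  (((k : ℝ≥0∞) + 1)⁻¹ • Measure.count : Measure (Fin (k + 1))).prod (expMeasure 1)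

instance (k : ℕ) :
    IsProbabilityMeasure (((k : ℝ≥0∞) + 1)⁻¹ • Measure.count : Measure (Fin (k + 1))) := by
  constructor
  rw [Measure.smul_apply, Measure.count_univ, smul_eq_mul]
  simp only [ENat.card_eq_coe_fintype_card, Fintype.card_fin]
  push_cast
  exact ENNReal.inv_mul_cancel (by simp) (by finiteness)

instance (k : ℕ) : IsProbabilityMeasure (edgeLaw k) := by
  rw [edgeLaw]
  infer_instance

lemma lintegral_edgeLaw (k : ℕ) {f : Fin (k + 1) × ℝ → ℝ≥0∞} (hf : Measurable f) :
    ∫⁻ z, f z ∂edgeLaw k = ((k : ℝ≥0∞) + 1)⁻¹ * ∑ u, ∫⁻ e, f (u, e) ∂expMeasure 1 := by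
  rw [edgeLaw, lintegral_prod _ hf.aemeasurable, lintegral_smul_measure, lintegral_count,
    tsum_fintype, smul_eq_mul]

lemma edgeLaw_apply (k : ℕ) {A : Set (Fin (k + 1) × ℝ)} (hA : MeasurableSet A) :
    edgeLaw k A = ((k : ℝ≥0∞) + 1)⁻¹ * ∑ u, expMeasure 1 (Prod.mk u ⁻¹' A) := by
  rw [← lintegral_indicator_one hA, lintegral_edgeLaw k (measurable_one.indicator hA)]
  congr 1
  refine Finset.sum_congr rfl fun u _ => ?_
  rw [← lintegral_indicator_one (measurable_prodMk_left hA)]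
  rfl

/-- The law of an infinite random recursive tree marked with independent standard exponential
removal times. -/
noncomputable def treeLaw : Measure MarkedTree := Measure.infinitePi edgeLaw

instance : IsProbabilityMeasure treeLaw := by
  rw [treeLaw]
  infer_instance

/-- Replacing one coordinate by an independent copy does not change a product law. -/
lemma map_update_infinitePi {ι : Type*} [DecidableEq ι] {X : ι → Type*}
    [∀ i, MeasurableSpace (X i)]
    (ν : (i : ι) → Measure (X i)) [∀ i, IsProbabilityMeasure (ν i)] (n : ι) :
    ((Measure.infinitePi ν).prod (ν n)).map (fun p => Function.update p.1 n p.2) =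
      Measure.infinitePi ν := by
  have hm : Measurable fun p : ((i : ι) → X i) × X n => Function.update p.1 n p.2 :=
    measurable_update'
  refine Measure.eq_infinitePi ν fun s t ht => ?_
  rw [Measure.map_apply hm (.pi s.countable_toSet fun i _ => ht i)]
  have : (fun p : ((i : ι) → X i) × X n => Function.update p.1 n p.2) ⁻¹' Set.pi s t =
      (Set.pi (s.erase n : Finset ι) t) ×ˢ (if n ∈ s then t n else Set.univ) := by
    ext ⟨x, z⟩
    simp only [Set.mem_preimage, Set.mem_pi, Finset.mem_coe, Set.mem_prod, Finset.mem_erase]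
    constructor
    · intro h
      refine ⟨fun i hi => by simpa [hi.1] using h i hi.2, ?_⟩
      split_ifs with hn
      · simpa using h n hn
      · trivial
    · rintro ⟨h1, h2⟩ i hi
      by_cases hin : i = n
      · subst hin
        rw [if_pos hi] at h2
        simpa using h2
      · simpa [hin] using h1 i ⟨hin, hi⟩
  rw [this, Measure.prod_prod, Measure.infinitePi_pi _ fun i _ => ht i]
  split_ifs with hn
  · rw [mul_comm, Finset.mul_prod_erase s (fun i => ν i (t i)) hn]
  · rw [measure_univ, mul_one, Finset.erase_eq_of_notMem hn]

lemma lintegral_treeLaw_update (n : ℕ) {f : MarkedTree → ℝ≥0∞} (hf : Measurable f) :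
    ∫⁻ x, f x ∂treeLaw = ∫⁻ x, ∫⁻ z, f (Function.update x n z) ∂edgeLaw n ∂treeLaw := by
  have hm : Measurable fun p : MarkedTree × (Fin (n + 1) × ℝ) => Function.update p.1 n p.2 :=
    measurable_update'
  conv_lhs => rw [treeLaw, ← map_update_infinitePi edgeLaw n]
  rw [lintegral_map hf hm, lintegral_prod (fun p => f (Function.update p.1 n p.2))
    (hf.comp hm).aemeasurable]
  rfl

lemma edgeLaw_snd {k : ℕ} (A : Set ℝ) :
    edgeLaw k {z | z.2 ∈ A} = expMeasure 1 A := by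
  have : {z : Fin (k + 1) × ℝ | z.2 ∈ A} = Set.univ ×ˢ A := by
    ext z
    simp
  rw [this, edgeLaw, Measure.prod_prod, measure_univ, one_mul]

/-- The probability that the vertex `k + 1` is attached at time `t` to a vertex satisfying `P`. -/
lemma edgeLaw_attach (k : ℕ) (P : ℕ → Prop) [DecidablePred P] {t : ℝ} (ht : 0 ≤ t) :
    edgeLaw k {z | t < z.2 ∧ P z.1} =
      ENNReal.ofReal (Real.exp (-t) * (Nat.count P (k + 1) / ((k : ℝ) + 1))) := by
  have h1 : {z : Fin (k + 1) × ℝ | t < z.2 ∧ P z.1} = {u : Fin (k + 1) | P u} ×ˢ Set.Ioi t := by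
    ext z
    simp [and_comm]
  have h2 : (Measure.count {u : Fin (k + 1) | P u} : ℝ≥0∞) = (Nat.count P (k + 1) : ℝ≥0∞) := by
    rw [Nat.count_eq_card_filter_range, Finset.card_filter,
      ← Fin.sum_univ_eq_sum_range (fun i => if P i then 1 else 0) (k + 1), ← Finset.card_filter,
      ← Measure.count_apply_finset]
    simp
  rw [h1, edgeLaw, Measure.prod_prod, expMeasure_Ioi ht, Measure.smul_apply, h2, smul_eq_mul,
    mul_comm, ENNReal.ofReal_mul (Real.exp_pos _).le, ENNReal.ofReal_div_of_pos (by positivity),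
    ENNReal.ofReal_natCast, ENNReal.ofReal_add (by positivity) zero_le_one, ENNReal.ofReal_natCast,
    ENNReal.ofReal_one, ENNReal.div_eq_inv_mul]

lemma treeLaw_coord {k : ℕ} {A : Set (Fin (k + 1) × ℝ)} (hA : MeasurableSet A) :
    treeLaw {x | x k ∈ A} = edgeLaw k A := by
  rw [← Measure.infinitePi_map_eval edgeLaw k, Measure.map_apply (measurable_pi_apply k) hA]
  rfl

lemma ae_treeLaw_pos : ∀ᵐ x ∂treeLaw, ∀ k, 0 < (x k).2 := by
  rw [ae_all_iff]
  intro k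
  have h0 : expMeasure 1 (Set.Ioi 0)ᶜ = 0 := by
    rw [prob_compl_eq_zero_iff measurableSet_Ioi, expMeasure_Ioi le_rfl]
    simp
  rw [ae_iff]
  have := edgeLaw_snd (k := k) (Set.Ioi (0 : ℝ))ᶜ
  rw [h0, ← treeLaw_coord (A := {z : Fin (k + 1) × ℝ | z.2 ∈ (Set.Ioi (0 : ℝ))ᶜ})
    (measurable_snd measurableSet_Ioi.compl)] at this
  exact this

section JointLaw

variable {Ω : Type*} [MeasurableSpace Ω] {μ : Measure Ω}

/-- If two families of random variables are independent of each other and each consists of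
independent random variables, then the pairs formed from both families are independent. -/
lemma iIndepFun_prodMk {ι : Type*} {α β : ι → Type*} [∀ i, MeasurableSpace (α i)]
    [∀ i, MeasurableSpace (β i)] {X : (i : ι) → Ω → α i} {Y : (i : ι) → Ω → β i}
    (hX : ∀ i, Measurable (X i)) (hY : ∀ i, Measurable (Y i))
    (hXi : iIndepFun X μ) (hYi : iIndepFun Y μ)
    (hXY : IndepFun (fun ω i => X i ω) (fun ω i => Y i ω) μ) :
    iIndepFun (fun i ω => (X i ω, Y i ω)) μ := by
  rw [iIndepFun_iff_iIndep]
  refine iIndepSets.iIndep (fun i => ((hX i).prodMk (hY i)).comap_le)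
    (fun i => Set.preimage (fun ω => (X i ω, Y i ω)) ''
      (Set.image2 (· ×ˢ ·) {s | MeasurableSet s} {t | MeasurableSet t}))
    (fun i => ?_) (fun i => ?_) ?_
  · exact isPiSystem_prod.comap _
  · rw [← generateFrom_prod, MeasurableSpace.comap_generateFrom]
  · rw [iIndepSets_iff]
    intro S f hf
    have hf' : ∀ i, ∃ A : Set (α i), ∃ B : Set (β i), MeasurableSet A ∧ MeasurableSet B ∧
        (i ∈ S → f i = X i ⁻¹' A ∩ Y i ⁻¹' B) := by
      intro i
      by_cases hi : i ∈ S
      · obtain ⟨_, ⟨A, hA, B, hB, rfl⟩, h⟩ := hf i hi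
        exact ⟨A, B, hA, hB, fun _ => h.symm⟩
      · exact ⟨∅, ∅, .empty, .empty, fun h => absurd h hi⟩
    choose A B hA hB hAB using hf'
    have hpair : ∀ i, IndepFun (X i) (Y i) μ := fun i =>
      hXY.comp (measurable_pi_apply i) (measurable_pi_apply i)
    have h1 : (⋂ i ∈ S, f i) = ((fun ω i => X i ω) ⁻¹' Set.pi S A) ∩
        ((fun ω i => Y i ω) ⁻¹' Set.pi S B) := by
      ext ω
      simp only [Set.mem_iInter, Set.mem_inter_iff, Set.mem_preimage, Set.mem_pi, Finset.mem_coe]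
      constructor
      · intro h
        exact ⟨fun i hi => ((hAB i hi) ▸ h i hi).1, fun i hi => ((hAB i hi) ▸ h i hi).2⟩
      · rintro ⟨ha, hb⟩ i hi
        rw [hAB i hi]
        exact ⟨ha i hi, hb i hi⟩
    rw [h1, hXY.measure_inter_preimage_eq_mul _ _ (.pi S.countable_toSet fun i _ => hA i)
      (.pi S.countable_toSet fun i _ => hB i)]
    have h2 : (fun ω i => X i ω) ⁻¹' Set.pi S A = ⋂ i ∈ S, X i ⁻¹' A i := by
      ext; simp
    have h3 : (fun ω i => Y i ω) ⁻¹' Set.pi S B = ⋂ i ∈ S, Y i ⁻¹' B i := by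
      ext; simp
    rw [h2, h3, hXi.measure_inter_preimage_eq_mul S fun i _ => hA i,
      hYi.measure_inter_preimage_eq_mul S fun i _ => hB i, ← Finset.prod_mul_distrib]
    refine Finset.prod_congr rfl fun i hi => ?_
    rw [hAB i hi, (hpair i).measure_inter_preimage_eq_mul _ _ (hA i) (hB i)]

variable {parent : (k : ℕ) → Ω → Fin (k + 1)} {clock : ℕ → Ω → ℝ}

lemma IsRecursiveTreeWithClocks.measurable_markedTree
    (h : IsRecursiveTreeWithClocks μ parent clock) : Measurable (markedTree parent clock) :=
  measurable_pi_lambda _ fun k => (h.measurable_parent k).prodMk (h.measurable_clock k)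

lemma IsRecursiveTreeWithClocks.map_markedTree [IsProbabilityMeasure μ]
    (h : IsRecursiveTreeWithClocks μ parent clock) :
    μ.map (markedTree parent clock) = treeLaw := by
  have hi : iIndepFun (fun k ω => (parent k ω, clock k ω)) μ :=
    iIndepFun_prodMk h.measurable_parent h.measurable_clock h.parent_indep h.clock_indep
      h.parent_clock_indep
  have := hi.map_fun_eq_infinitePi_map
    fun k => (h.measurable_parent k).prodMk (h.measurable_clock k)
  refine this.trans ?_
  rw [treeLaw]
  congr 1
  ext1 k
  have hk : IndepFun (parent k) (clock k) μ :=
    h.parent_clock_indep.comp (measurable_pi_apply k) (measurable_pi_apply k)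
  rw [hk.map_prod_eq_prod_map_map (h.measurable_parent k).aemeasurable
    (h.measurable_clock k).aemeasurable, h.clock_exponential, edgeLaw]
  congr 1
  refine Measure.ext_of_singleton fun j => ?_
  rw [Measure.map_apply (h.measurable_parent k) (.singleton j), h.parent_uniform,
    Measure.smul_apply, Measure.count_singleton, smul_eq_mul, mul_one]

end JointLaw

/-! ### Generalized rising factorials -/

/-- `∏_{1 ≤ i < n} (1 + q / i)`, set to `0` for `n = 0`. It is the ratio of `Γ (n + q)` to
`Γ (n) Γ (1 + q)`. -/
noncomputable def risingRatio (q : ℝ) (n : ℕ) : ℝ :=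
  if n = 0 then 0 else ∏ i ∈ Finset.range (n - 1), (1 + q / (i + 1))

lemma risingRatio_zero (q : ℝ) : risingRatio q 0 = 0 := if_pos rfl

lemma risingRatio_one (q : ℝ) : risingRatio q 1 = 1 := by simp [risingRatio]

lemma risingRatio_succ (q : ℝ) {n : ℕ} (hn : n ≠ 0) :
    risingRatio q (n + 1) = risingRatio q n * (1 + q / n) := by
  obtain ⟨m, rfl⟩ := Nat.exists_eq_succ_of_ne_zero hn
  simp only [risingRatio, Nat.succ_ne_zero, if_false, Nat.succ_eq_add_one,
    Nat.add_sub_cancel]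
  rw [Finset.prod_range_succ]
  push_cast
  rfl

lemma risingRatio_pos {q : ℝ} (hq : -1 < q) {n : ℕ} (hn : n ≠ 0) : 0 < risingRatio q n := by
  rw [risingRatio, if_neg hn]
  refine Finset.prod_pos fun i _ => ?_
  have : (0 : ℝ) < i + 1 := by positivity
  rw [one_add_div this.ne']
  exact div_pos (by linarith [(Nat.cast_nonneg i : (0 : ℝ) ≤ i)]) this

lemma risingRatio_nonneg {q : ℝ} (hq : -1 < q) (n : ℕ) : 0 ≤ risingRatio q n := by
  rcases eq_or_ne n 0 with rfl | hn
  · rw [risingRatio_zero]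
  · exact (risingRatio_pos hq hn).le

lemma risingRatio_one_left (n : ℕ) : risingRatio 1 n = n := by
  induction n with
  | zero => simp [risingRatio_zero]
  | succ n ih =>
    rcases eq_or_ne n 0 with rfl | hn
    · simp [risingRatio_one]
    · rw [risingRatio_succ _ hn, ih]
      field_simp
      push_cast
      rfl

lemma risingRatio_add_two (q : ℝ) (n : ℕ) : risingRatio q (n + 2) =
    (∏ j ∈ Finset.range (n + 1), (q + 1 + j)) / ((n + 1) * n.factorial) := by
  induction n with
  | zero =>
    rw [risingRatio_succ _ one_ne_zero, risingRatio_one]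
    simp [add_comm]
  | succ n ih =>
    rw [risingRatio_succ _ (by omega), ih, Finset.prod_range_succ _ (n + 1), Nat.factorial_succ]
    have : (n.factorial : ℝ) ≠ 0 := by positivity
    push_cast
    field_simp
    ring

/-- The asymptotic growth of `risingRatio`, a form of Euler's limit formula for `Γ`. -/
lemma tendsto_risingRatio {q : ℝ} (hq : -1 < q) :
    Tendsto (fun n : ℕ => risingRatio q n * (n : ℝ) ^ (-q)) atTop (𝓝 (Real.Gamma (q + 1))⁻¹) := by
  have hG : 0 < Real.Gamma (q + 1) := Real.Gamma_pos_of_pos (by linarith)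
  have h1 := (Real.GammaSeq_tendsto_Gamma (q + 1)).inv₀ hG.ne'
  rw [← tendsto_add_atTop_iff_nat 2]
  have h2 : Tendsto (fun n : ℕ => (n : ℝ) / (n + (1 : ℝ))) atTop (𝓝 1) :=
    tendsto_natCast_div_add_atTop 1
  have h3 : Tendsto (fun n : ℕ => (n : ℝ) / (n + (2 : ℝ))) atTop (𝓝 1) :=
    tendsto_natCast_div_add_atTop 2
  have h4 := (h1.mul h2).mul (h3.rpow_const (p := q) (Or.inl one_ne_zero))
  rw [Real.one_rpow, mul_one, mul_one] at h4
  refine h4.congr' ?_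
  filter_upwards [eventually_gt_atTop 0] with n hn
  have hn' : (0 : ℝ) < n := by exact_mod_cast hn
  rw [risingRatio_add_two, Real.GammaSeq, Real.div_rpow hn'.le (by positivity),
    Real.rpow_add hn', Real.rpow_one]
  push_cast
  rw [Real.rpow_neg (by positivity)]
  have h5 : (0 : ℝ) < (n : ℝ) ^ q := by positivity
  have h6 : (0 : ℝ) < ((n : ℝ) + 2) ^ q := by positivity
  field_simp

/-- `risingRatio q` and `risingRatio (2 * q)` grow like `n ^ q` and `n ^ (2 * q)`. -/
lemma exists_risingRatio_sq_le {q : ℝ} (hq : 0 ≤ q) :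
    ∃ C, ∀ n, risingRatio q n ^ 2 ≤ C * risingRatio (2 * q) n := by
  have h1 := (tendsto_risingRatio (q := q) (by linarith)).pow 2
  have h2 := (tendsto_risingRatio (q := 2 * q) (by linarith)).inv₀
    (inv_ne_zero (Real.Gamma_pos_of_pos (by linarith)).ne')
  obtain ⟨C, hC⟩ := (h1.mul h2).bddAbove_range
  refine ⟨C, fun n => ?_⟩
  rcases eq_or_ne n 0 with rfl | hn
  · simp [risingRatio_zero]
  · have hn' : (0 : ℝ) < n := by positivity
    have hp := risingRatio_pos (q := 2 * q) (by linarith) hn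
    have h3 := hC ⟨n, rfl⟩
    rw [← div_le_iff₀ hp]
    refine le_trans (le_of_eq ?_) h3
    have h4 : (n : ℝ) ^ (-(2 * q)) = ((n : ℝ) ^ (-q)) ^ 2 := by
      rw [← Real.rpow_natCast, ← Real.rpow_mul hn'.le]
      congr 1
      push_cast
      ring
    have h5 : (0 : ℝ) < (n : ℝ) ^ (-q) := by positivity
    simp only [h4]
    field_simp

lemma risingRatio_two_mul_le {q : ℝ} (hq : 0 ≤ q) (n : ℕ) :
    risingRatio (2 * q) n ≤ risingRatio q n ^ 2 := by
  induction n with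
  | zero => simp [risingRatio_zero]
  | succ n ih =>
    rcases eq_or_ne n 0 with rfl | hn
    · simp [risingRatio_one]
    · rw [risingRatio_succ _ hn, risingRatio_succ _ hn, mul_pow]
      refine mul_le_mul ih ?_ (by positivity) (by positivity)
      rw [mul_div_assoc]
      nlinarith [sq_nonneg (q / n)]

/-- A telescoping sum: `n / risingRatio c n` has increments `-(c - 1) / risingRatio c (n + 1)`. -/
lemma hasSum_inv_risingRatio {c : ℝ} (hc : 1 < c) :
    HasSum (fun n : ℕ => (risingRatio c (n + 2))⁻¹) (c - 1)⁻¹ := by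
  have hpos : ∀ n : ℕ, 0 < risingRatio c (n + 1) := fun n =>
    risingRatio_pos (by linarith) n.succ_ne_zero
  have hsum : ∀ n : ℕ, ∑ i ∈ Finset.range n, (risingRatio c (i + 2))⁻¹ =
      (c - 1)⁻¹ * (1 - (n + 1) / risingRatio c (n + 1)) := by
    intro n
    have hc' : c - 1 ≠ 0 := by linarith
    induction n with
    | zero => simp [risingRatio_one]
    | succ n ih =>
      have hp := (hpos n).ne'
      have hnc : (n : ℝ) + 1 + c ≠ 0 := by positivity
      rw [Finset.sum_range_succ, ih, risingRatio_succ c (n := n + 1) (by omega)]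
      have : 1 + c / ((n + 1 : ℕ) : ℝ) = (n + 1 + c) / (n + 1) := by
        push_cast
        field_simp
      rw [this]
      push_cast
      field_simp
      ring
  refine (hasSum_iff_tendsto_nat_of_nonneg (fun n => (inv_pos.2 (hpos (n + 1))).le) _).2 ?_
  simp_rw [hsum]
  have h0 : Tendsto (fun n : ℕ => (n : ℝ) / risingRatio c n) atTop (𝓝 0) := by
    have h1 := ((tendsto_risingRatio (q := c) (by linarith)).inv₀
      (inv_ne_zero (Real.Gamma_pos_of_pos (by linarith)).ne'))
    have h2 : Tendsto (fun n : ℕ => (n : ℝ) ^ (-(c - 1))) atTop (𝓝 0) :=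
      (tendsto_rpow_neg_atTop (by linarith)).comp tendsto_natCast_atTop_atTop
    have h3 := h1.mul h2
    rw [mul_zero] at h3
    refine h3.congr' ?_
    filter_upwards [eventually_gt_atTop 0] with n hn
    have hn' : (0 : ℝ) < n := by exact_mod_cast hn
    rw [neg_sub, Real.rpow_sub hn', Real.rpow_one, Real.rpow_neg hn'.le]
    have : (0 : ℝ) < (n : ℝ) ^ c := by positivity
    field_simp
  have h1 := (tendsto_add_atTop_iff_nat 1).2 h0
  push_cast at h1
  simpa using (h1.const_sub 1).const_mul (c - 1)⁻¹

/-! ### Block sizes -/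

/-- The number of vertices among the first `n` ones that belong to the block with root `b`. -/
noncomputable def blockSize (t : ℝ) (x : MarkedTree) (b n : ℕ) : ℕ :=
  Nat.count (fun v => blockRoot t x v = b) n

lemma measurable_eval_of_countable {α β γ : Type*} [MeasurableSpace α] [MeasurableSpace β]
    [MeasurableSpace γ] [Countable β] [MeasurableSingletonClass β] {f : β → α → γ} {i : α → β}
    (hf : ∀ b, Measurable (f b)) (hi : Measurable i) : Measurable fun a => f (i a) a :=
  (measurable_from_prod_countable_left (f := fun p : α × β => f p.2 p.1) hf).comp
    (measurable_id.prodMk hi)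

lemma measurable_blockRoot (t : ℝ) (v : ℕ) : Measurable fun x => blockRoot t x v := by
  induction v using Nat.strong_induction_on with
  | _ v ih =>
    cases v with
    | zero => simp only [blockRoot_zero, measurable_const]
    | succ k =>
      simp only [blockRoot_succ]
      refine Measurable.ite (measurableSet_lt measurable_const (by fun_prop)) ?_ measurable_const
      exact measurable_eval_of_countable (f := fun (u : Fin (k + 1)) x => blockRoot t x u)
        (fun u => ih u u.2) (i := fun x => (x k).1) (by fun_prop)

lemma measurableSet_blockRoot_eq (t : ℝ) (v b : ℕ) :
    MeasurableSet {x | blockRoot t x v = b} :=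
  measurable_blockRoot t v (measurableSet_singleton b)

lemma blockSize_succ (t : ℝ) (x : MarkedTree) (b n : ℕ) :
    blockSize t x b (n + 1) = blockSize t x b n + if blockRoot t x n = b then 1 else 0 :=
  Nat.count_succ _ _

lemma measurable_blockSize (t : ℝ) (b n : ℕ) : Measurable fun x => blockSize t x b n := by
  induction n with
  | zero => simp [blockSize]
  | succ n ih =>
    simp only [blockSize_succ]
    exact ih.add (Measurable.ite (measurableSet_blockRoot_eq t n b) measurable_const
      measurable_const)

lemma blockSize_congr {t : ℝ} {x y : MarkedTree} {b n : ℕ} (h : ∀ k < n, x k = y k) :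
    blockSize t x b (n + 1) = blockSize t y b (n + 1) := by
  rw [blockSize, blockSize, Nat.count_eq_card_filter_range, Nat.count_eq_card_filter_range]
  congr 1
  refine Finset.filter_congr fun v hv => ?_
  rw [blockRoot_congr fun k hk => h k (by have := Finset.mem_range.1 hv; omega)]

lemma blockSize_self (t : ℝ) (x : MarkedTree) (b : ℕ) :
    blockSize t x b (b + 1) = if blockRoot t x b = b then 1 else 0 := by
  rw [blockSize_succ, blockSize, Nat.count_iff_forall_not.2, zero_add]
  intro v hv h
  have := blockRoot_le t x v
  omega

lemma blockSize_eq_zero {t : ℝ} {x : MarkedTree} {b : ℕ} (h : blockRoot t x b ≠ b) (n : ℕ) :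
    blockSize t x b n = 0 := by
  rw [blockSize, Nat.count_iff_forall_not]
  rintro v - rfl
  exact h (blockRoot_blockRoot t x v)

lemma blockSize_pos {t : ℝ} {x : MarkedTree} {b n : ℕ} (h : blockRoot t x b = b) (hn : b < n) :
    0 < blockSize t x b n := by
  rw [Nat.pos_iff_ne_zero, blockSize, Nat.count_ne_iff_exists]
  exact ⟨b, hn, h⟩

lemma blockSize_le (t : ℝ) (x : MarkedTree) (b n : ℕ) : blockSize t x b n ≤ n := Nat.count_le _

lemma scaledCount_block (t : ℝ) (x : MarkedTree) (b n : ℕ) :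
    scaledCount t {v | blockRoot t x v = b} n = (n : ℝ) ^ (-Real.exp (-t)) * blockSize t x b n := by
  rw [scaledCount, blockSize, Nat.count_eq_card_filter_range, ← Set.ncard_coe_finset]
  congr 4
  ext v
  simp [and_comm]

/-! ### The martingales of a block -/

/-- Replace the edges of the vertices `n + 1, n + 2, …` by fixed ones, so that the result depends only on
the first `n` edges. -/
def truncate (n : ℕ) (x : MarkedTree) : MarkedTree := fun k => if k < n then x k else (0, 0)

lemma measurable_truncate (n : ℕ) : Measurable (truncate n) := by
  refine measurable_pi_lambda _ fun k => ?_
  by_cases h : k < n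
  · simpa [truncate, h] using measurable_pi_apply k
  · simp [truncate, h]

lemma truncate_truncate {m n : ℕ} (h : m ≤ n) (x : MarkedTree) :
    truncate m (truncate n x) = truncate m x := by
  ext1 k
  simp only [truncate]
  split_ifs with h1 h2
  · rfl
  · omega
  · rfl

lemma truncate_update (n : ℕ) (x : MarkedTree) (z : Fin (n + 1) × ℝ) :
    truncate n (Function.update x n z) = truncate n x := by
  ext1 k
  simp only [truncate]
  split_ifs with h
  · rw [Function.update_of_ne h.ne]
  · rfl

/-- The filtration generated by the edges, started at the vertex `b`. -/
def edgeFiltration (b : ℕ) : Filtration ℕ (inferInstance : MeasurableSpace MarkedTree) where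
  seq n := MeasurableSpace.comap (truncate (b + n)) inferInstance
  mono' m n hmn := by
    rintro _ ⟨s, hs, rfl⟩
    refine ⟨truncate (b + m) ⁻¹' s, measurable_truncate _ hs, ?_⟩
    ext x
    simp only [Set.mem_preimage, truncate_truncate (show b + m ≤ b + n by omega)]
  le' n := (measurable_truncate _).comap_le

/-- The martingale `risingRatio q N / risingRatio (e^{-t} q) m`, where `N` is the size among the
first `m = b + n + 1` vertices of the block with root `b`. -/
noncomputable def blockMartingale (t q : ℝ) (b n : ℕ) (x : MarkedTree) : ℝ :=
  risingRatio q (blockSize t x b (b + n + 1)) / risingRatio (Real.exp (-t) * q) (b + n + 1)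

lemma measurable_blockMartingale (t q : ℝ) (b n : ℕ) : Measurable (blockMartingale t q b n) :=
  ((measurable_of_countable (risingRatio q)).comp (measurable_blockSize t b _)).div_const _

lemma exp_neg_mul_gt {t q : ℝ} (ht : 0 ≤ t) (hq : -1 < q) : -1 < Real.exp (-t) * q := by
  have h1 : Real.exp (-t) ≤ 1 := Real.exp_le_one_iff.2 (by linarith)
  nlinarith [Real.exp_pos (-t)]

lemma blockMartingale_nonneg {t q : ℝ} (ht : 0 ≤ t) (hq : -1 < q) (b n : ℕ) (x : MarkedTree) :
    0 ≤ blockMartingale t q b n x :=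
  div_nonneg (risingRatio_nonneg hq _) (risingRatio_nonneg (exp_neg_mul_gt ht hq) _)

lemma integrable_blockMartingale (t q : ℝ) (b n : ℕ) :
    Integrable (blockMartingale t q b n) treeLaw := by
  refine Integrable.div_const ?_ _
  obtain ⟨C, hC⟩ := ((Finset.range (b + n + 2)).finite_toSet.image
    fun N => ‖risingRatio q N‖).bddAbove
  refine Integrable.of_bound ((measurable_of_countable (risingRatio q)).comp
    (measurable_blockSize t b _)).aestronglyMeasurable C (ae_of_all _ fun x => ?_)
  refine hC ⟨_, ?_, rfl⟩
  have := blockSize_le t x b (b + n + 1)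
  simp only [Finset.coe_range, Set.mem_Iio]
  omega

lemma integral_treeLaw_update (n : ℕ) {f : MarkedTree → ℝ} (hf : Integrable f treeLaw) :
    ∫ x, f x ∂treeLaw = ∫ x, ∫ z, f (Function.update x n z) ∂edgeLaw n ∂treeLaw := by
  have hm : Measurable fun p : MarkedTree × (Fin (n + 1) × ℝ) => Function.update p.1 n p.2 :=
    measurable_update'
  have hmap := map_update_infinitePi edgeLaw n
  have hf' := hf
  rw [treeLaw, ← hmap] at hf'
  conv_lhs => rw [treeLaw, ← hmap]
  rw [integral_map hm.aemeasurable hf'.aestronglyMeasurable]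
  exact integral_prod _ ((integrable_map_measure hf'.aestronglyMeasurable hm.aemeasurable).1 hf')

/-- Averaging over the edge above the next vertex: the vertex joins the block with root `b` with
probability `e^{-t} N / m`, where `N` is the size of the block and `m` the number of vertices. -/
lemma integral_blockMartingale_update {t : ℝ} (ht : 0 ≤ t) {q : ℝ} (hq : -1 < q) (b n : ℕ)
    (x : MarkedTree) :
    ∫ z, blockMartingale t q b (n + 1) (Function.update x (b + n) z) ∂edgeLaw (b + n) =
      blockMartingale t q b n x := by
  set N := blockSize t x b (b + n + 1) with hN
  set A : Set (Fin (b + n + 1) × ℝ) := {z | t < z.2 ∧ blockRoot t x z.1 = b} with hA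
  have hAm : MeasurableSet A :=
    (measurableSet_lt measurable_const measurable_snd).inter
      (measurable_fst (MeasurableSet.of_discrete (s := {u : Fin (b + n + 1) | blockRoot t x u = b})))
  set D := risingRatio (Real.exp (-t) * q) (b + n + 2) with hD
  have key : ∀ z, blockMartingale t q b (n + 1) (Function.update x (b + n) z) =
      risingRatio q N / D +
        A.indicator (fun _ => (risingRatio q (N + 1) - risingRatio q N) / D) z := by
    intro z
    have hlt : ∀ k < b + n, Function.update x (b + n) z k = x k := fun k hk =>
      Function.update_of_ne hk.ne _ _
    have h1 : blockSize t (Function.update x (b + n) z) b (b + n + 1) = N := blockSize_congr hlt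
    have h2 : blockRoot t (Function.update x (b + n) z) (b + n + 1) = b ↔ z ∈ A := by
      rw [blockRoot_succ, Function.update_self, hA, Set.mem_ofPred_eq]
      split_ifs with h
      · rw [blockRoot_congr fun k hk => hlt k (by have := z.1.2; omega)]
        simp [h]
      · simp only [h, false_and, iff_false]
        omega
    rw [blockMartingale, show b + (n + 1) + 1 = b + n + 1 + 1 by ring, blockSize_succ, h1,
      if_congr h2 rfl rfl]
    by_cases hz : z ∈ A
    · rw [if_pos hz, Set.indicator_of_mem hz]
      ring
    · rw [if_neg hz, Set.indicator_of_notMem hz]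
      simp [hD]
  have hreal : (edgeLaw (b + n)).real A = Real.exp (-t) * (N / ((b + n : ℕ) + 1)) := by
    rw [measureReal_def, hA,
      edgeLaw_attach (b + n) (fun v => blockRoot t x v = b) ht, ENNReal.toReal_ofReal (by positivity)]
    rfl
  simp_rw [key]
  rw [integral_add (integrable_const _) ((integrable_const _).indicator hAm), integral_const,
    integral_indicator_const _ hAm, hreal, blockMartingale, ← hN]
  have hr := risingRatio_pos (exp_neg_mul_gt ht hq) (Nat.succ_ne_zero (b + n))
  have hr2 := risingRatio_pos (exp_neg_mul_gt ht hq) (Nat.succ_ne_zero (b + n + 1))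
  have hD' : D = risingRatio (Real.exp (-t) * q) (b + n + 1) *
      (1 + (Real.exp (-t) * q) / ((b + n : ℕ) + 1)) := by
    rw [hD, risingRatio_succ _ (Nat.succ_ne_zero (b + n))]
    push_cast
    rfl
  have hDpos : 0 < D := hr2
  rw [probReal_univ, one_smul, smul_eq_mul, ← mul_div_assoc, ← add_div,
    div_eq_div_iff hDpos.ne' hr.ne', hD']
  rcases Nat.eq_zero_or_pos N with h0 | h0
  · simp [h0, risingRatio_zero]
  · rw [risingRatio_succ _ h0.ne']
    have hN0 : (N : ℝ) ≠ 0 := by exact_mod_cast h0.ne'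
    have hbn : (((b + n : ℕ) : ℝ) + 1) ≠ 0 := by positivity
    field_simp
    ring

lemma martingale_blockMartingale {t : ℝ} (ht : 0 ≤ t) {q : ℝ} (hq : -1 < q) (b : ℕ) :
    Martingale (blockMartingale t q b) (edgeFiltration b) treeLaw := by
  refine martingale_of_setIntegral_eq_succ (fun n => ?_) (integrable_blockMartingale t q b) ?_
  · refine Measurable.stronglyMeasurable fun s hs =>
      ⟨blockMartingale t q b n ⁻¹' s, measurable_blockMartingale t q b n hs, ?_⟩
    ext x
    have : blockMartingale t q b n (truncate (b + n) x) = blockMartingale t q b n x := by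
      rw [blockMartingale, blockMartingale,
        blockSize_congr (y := x) fun k hk => by simp [truncate, hk]]
    simp only [Set.mem_preimage, this]
  · rintro n _ ⟨s, hs, rfl⟩
    have hs' := measurable_truncate (b + n) hs
    rw [← integral_indicator hs', ← integral_indicator hs',
      integral_treeLaw_update (b + n) ((integrable_blockMartingale t q b (n + 1)).indicator hs')]
    refine integral_congr_ae (ae_of_all _ fun x => ?_)
    by_cases hx : x ∈ truncate (b + n) ⁻¹' s
    · have : ∀ z, Function.update x (b + n) z ∈ truncate (b + n) ⁻¹' s := fun z => by
        simpa [truncate_update] using hx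
      simp only [Set.indicator_of_mem hx, Set.indicator_of_mem (this _),
        integral_blockMartingale_update ht hq]
    · have : ∀ z, Function.update x (b + n) z ∉ truncate (b + n) ⁻¹' s := fun z => by
        simpa [truncate_update] using hx
      simp only [Set.indicator_of_notMem hx, Set.indicator_of_notMem (this _), integral_zero]

lemma treeLaw_real_blockRoot {t : ℝ} (ht : 0 ≤ t) (b : ℕ) :
    treeLaw.real {x | blockRoot t x b = b} = if b = 0 then 1 else 1 - Real.exp (-t) := by
  cases b with
  | zero => simp [blockRoot_zero]
  | succ k =>
    simp only [blockRoot_succ_eq_self_iff, Nat.succ_ne_zero, if_false]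
    have h1 := treeLaw_coord (k := k) (A := {z | z.2 ∈ Set.Iic t}) (measurable_snd measurableSet_Iic)
    rw [edgeLaw_snd, expMeasure_Iic ht] at h1
    rw [measureReal_def]
    refine (congrArg ENNReal.toReal h1).trans (ENNReal.toReal_ofReal ?_)
    simpa using ht

lemma integral_blockMartingale {t : ℝ} (ht : 0 ≤ t) {q : ℝ} (hq : -1 < q) (b n : ℕ) :
    ∫ x, blockMartingale t q b n x ∂treeLaw =
      (if b = 0 then 1 else 1 - Real.exp (-t)) / risingRatio (Real.exp (-t) * q) (b + 1) := by
  have h1 := (martingale_blockMartingale ht hq b).setIntegral_eq (Nat.zero_le n)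
    (@MeasurableSet.univ _ (edgeFiltration b 0))
  rw [setIntegral_univ, setIntegral_univ] at h1
  rw [← h1, ← treeLaw_real_blockRoot ht b]
  have h2 : ∀ x, blockMartingale t q b 0 x = {x | blockRoot t x b = b}.indicator
      (fun _ => (risingRatio (Real.exp (-t) * q) (b + 1))⁻¹) x := by
    intro x
    rw [blockMartingale, add_zero, blockSize_self]
    by_cases h : blockRoot t x b = b
    · rw [if_pos h, Set.indicator_of_mem (by exact h), risingRatio_one, one_div]
    · rw [if_neg h, Set.indicator_of_notMem (by exact h), risingRatio_zero, zero_div]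
  simp_rw [h2]
  rw [integral_indicator_const _ (measurableSet_blockRoot_eq t b b), smul_eq_mul, div_eq_mul_inv]

/-- Almost sure convergence of the martingale of a block, in terms of powers. -/
lemma ae_tendsto_risingRatio_blockSize {t : ℝ} (ht : 0 ≤ t) {q : ℝ} (hq : -1 < q) (b : ℕ) :
    ∀ᵐ x ∂treeLaw, ∃ L, Tendsto (fun n : ℕ => risingRatio q (blockSize t x b n) *
      (n : ℝ) ^ (-(Real.exp (-t) * q))) atTop (𝓝 L) := by
  have hbdd : ∀ n, eLpNorm (blockMartingale t q b n) 1 treeLaw ≤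
      ((∫ x, blockMartingale t q b 0 x ∂treeLaw).toNNReal : ℝ≥0∞) := by
    intro n
    rw [eLpNorm_one_eq_lintegral_enorm, integral_blockMartingale ht hq b 0,
      ← integral_blockMartingale ht hq b n]
    refine le_of_eq ?_
    have : ∀ x, ‖blockMartingale t q b n x‖ₑ = ENNReal.ofReal (blockMartingale t q b n x) :=
      fun x => Real.enorm_of_nonneg (blockMartingale_nonneg ht hq b n x)
    simp_rw [this]
    rw [← ofReal_integral_eq_lintegral_ofReal (integrable_blockMartingale t q b n)
      (ae_of_all _ (blockMartingale_nonneg ht hq b n))]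
    rfl
  filter_upwards [(martingale_blockMartingale ht hq b).submartingale.exists_ae_tendsto_of_bdd hbdd]
    with x ⟨M, hx⟩
  have h1 := tendsto_risingRatio (exp_neg_mul_gt ht hq)
  refine ⟨M * (Real.Gamma (Real.exp (-t) * q + 1))⁻¹, ?_⟩
  rw [← tendsto_add_atTop_iff_nat (b + 1)]
  refine (hx.mul ((tendsto_add_atTop_iff_nat (b + 1)).2 h1)).congr fun n => ?_
  have hr := (risingRatio_pos (exp_neg_mul_gt ht hq) (Nat.succ_ne_zero (b + n))).ne'
  rw [blockMartingale, show n + (b + 1) = b + n + 1 by ring, ← mul_assoc, div_mul_cancel₀ _ hr]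

/-! ### Weights of the blocks -/

/-- Almost surely, the sizes of a block, suitably rescaled, have a positive limit. Convergence comes
from the martingale with `q = 1`; the limit does not vanish because the martingale with `q = -1/2`,
which is of the order of the inverse square root of the rescaled size, converges as well. -/
lemma ae_exists_tendsto_blockSize {t : ℝ} (ht : 0 ≤ t) (b : ℕ) :
    ∀ᵐ x ∂treeLaw, ∃ W : ℝ, Tendsto (fun n : ℕ => (n : ℝ) ^ (-Real.exp (-t)) * blockSize t x b n)
      atTop (𝓝 W) ∧ (blockRoot t x b = b → 0 < W) := by
  filter_upwards [ae_tendsto_risingRatio_blockSize ht (q := 1) (by norm_num) b,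
    ae_tendsto_risingRatio_blockSize ht (q := -(1 / 2)) (by norm_num) b] with x ⟨W, hW⟩ ⟨L, hL⟩
  simp only [risingRatio_one_left, mul_one] at hW
  refine ⟨W, hW.congr fun n => mul_comm _ _, fun hb => ?_⟩
  have hr := (tendsto_risingRatio (q := -(1 / 2)) (by norm_num)).inv₀
    (inv_ne_zero (Real.Gamma_pos_of_pos (by norm_num)).ne')
  obtain ⟨C, hC⟩ := hr.bddAbove_range
  obtain ⟨K, hK⟩ := hL.bddAbove_range
  set p := Real.exp (-t) with hp
  -- the rescaled size is bounded below
  have hlow : ∀ n : ℕ, b < n → 1 ≤ (C * K) ^ 2 * (blockSize t x b n * (n : ℝ) ^ (-p)) := by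
    intro n hn
    set N := blockSize t x b n with hN
    have hN0 : 0 < N := blockSize_pos hb hn
    have hN1 : (0 : ℝ) < N := by exact_mod_cast hN0
    have hn1 : (0 : ℝ) < n := by exact_mod_cast (Nat.zero_le b).trans_lt hn
    have hr0 := risingRatio_pos (q := -(1 / 2)) (by norm_num) hN0.ne'
    have h1 : (risingRatio (-(1 / 2)) N * (N : ℝ) ^ (-(-(1 / 2) : ℝ)))⁻¹ ≤ C := hC ⟨N, rfl⟩
    have h2 : risingRatio (-(1 / 2)) N * (n : ℝ) ^ (-(p * -(1 / 2))) ≤ K := hK ⟨n, rfl⟩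
    have h3 : (n : ℝ) ^ (p * (1 / 2)) * ((N : ℝ) ^ (1 / 2 : ℝ))⁻¹ ≤ C * K := by
      refine le_trans (le_of_eq ?_) (mul_le_mul h1 h2 (by positivity) ?_)
      · rw [neg_neg, mul_neg, neg_neg]
        field_simp
      · exact le_trans (by positivity) h1
    have h4 := pow_le_pow_left₀ (by positivity) h3 2
    have h5 : ((n : ℝ) ^ (p * (1 / 2)) * ((N : ℝ) ^ (1 / 2 : ℝ))⁻¹) ^ 2 = (n : ℝ) ^ p * (N : ℝ)⁻¹ := by
      rw [mul_pow, ← Real.rpow_natCast, ← Real.rpow_mul hn1.le, inv_pow, ← Real.rpow_natCast,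
        ← Real.rpow_mul hN1.le, show p * (1 / 2) * ((2 : ℕ) : ℝ) = p by push_cast; ring,
        show (1 / 2 : ℝ) * ((2 : ℕ) : ℝ) = 1 by norm_num, Real.rpow_one]
    rw [h5] at h4
    rw [Real.rpow_neg hn1.le]
    calc (1 : ℝ) = ((n : ℝ) ^ p * (N : ℝ)⁻¹) * (N * ((n : ℝ) ^ p)⁻¹) := by field_simp
      _ ≤ _ := mul_le_mul_of_nonneg_right h4 (by positivity)
  have hlim : 1 ≤ (C * K) ^ 2 * W :=
    ge_of_tendsto (hW.const_mul _) ((eventually_gt_atTop b).mono hlow)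
  by_contra hneg
  nlinarith [sq_nonneg (C * K)]

lemma ae_tendsto_rootWeight {t : ℝ} (ht : 0 ≤ t) :
    ∀ᵐ x ∂treeLaw, ∀ b, blockRoot t x b = b → 0 < rootWeight t x b ∧
      Tendsto (scaledCount t {v | blockRoot t x v = b}) atTop (𝓝 (rootWeight t x b)) := by
  rw [ae_all_iff]
  intro b
  filter_upwards [ae_exists_tendsto_blockSize ht b] with x ⟨W, hW, hpos⟩ hb
  have h1 : Tendsto (scaledCount t {v | blockRoot t x v = b}) atTop (𝓝 W) :=
    hW.congr fun n => (scaledCount_block t x b n).symm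
  have h2 : rootWeight t x b = W := h1.limUnder_eq
  rw [h2]
  exact ⟨hpos hb, h1⟩

lemma measurable_rootWeight (t : ℝ) (b : ℕ) : Measurable fun x => rootWeight t x b := by
  have : ∀ n, StronglyMeasurable fun x => scaledCount t {v | blockRoot t x v = b} n := by
    intro n
    simp only [scaledCount_block]
    exact (((measurable_of_countable fun N : ℕ => (N : ℝ)).comp
      (measurable_blockSize t b n)).const_mul _).stronglyMeasurable
  exact (StronglyMeasurable.limUnder this).measurable

/-! ### The point measure of the logarithms of the weights -/

lemma lintegral_treeLogWeights (t : ℝ) (x : MarkedTree) {f : ℝ → ℝ≥0∞} (hf : Measurable f) :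
    ∫⁻ y, f y ∂treeLogWeights t x =
      ∑' b : ℕ, {x | blockRoot t x b = b}.indicator (fun x => f (Real.log (rootWeight t x b))) x := by
  rw [treeLogWeights, lintegral_sum_measure]
  simp_rw [lintegral_dirac' _ hf]
  exact tsum_subtype {b | blockRoot t x b = b} fun b => f (Real.log (rootWeight t x b))

lemma measurable_lintegral_treeLogWeights (t : ℝ) {f : ℝ → ℝ≥0∞} (hf : Measurable f) :
    Measurable fun x => ∫⁻ y, f y ∂treeLogWeights t x := by
  simp_rw [lintegral_treeLogWeights t _ hf]
  exact Measurable.tsum fun b => (hf.comp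
    (Real.measurable_log.comp (measurable_rootWeight t b))).indicator
      (measurableSet_blockRoot_eq t b b)

lemma measurable_treeLogWeights (t : ℝ) : Measurable (treeLogWeights t) := by
  refine Measure.measurable_of_measurable_coe _ fun B hB => ?_
  simp_rw [← lintegral_indicator_one hB]
  exact measurable_lintegral_treeLogWeights t (measurable_one.indicator hB)

/-! ### Moments of the weights -/

/-- The mean of the almost sure limit of nonnegative random variables with constant mean and bounded
second moments. -/
lemma lintegral_eq_of_ae_tendsto_of_sq_bounded {Ω : Type*} [MeasurableSpace Ω] {μ : Measure Ω}
    [IsProbabilityMeasure μ] {X : ℕ → Ω → ℝ} {Y : Ω → ℝ} {m K : ℝ}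
    (hX : ∀ n, Measurable (X n)) (hX0 : ∀ n ω, 0 ≤ X n ω)
    (hmean : ∀ n, ∫⁻ ω, ENNReal.ofReal (X n ω) ∂μ = ENNReal.ofReal m)
    (hsq : ∀ n, ∫⁻ ω, ENNReal.ofReal (X n ω ^ 2) ∂μ ≤ ENNReal.ofReal K)
    (hlim : ∀ᵐ ω ∂μ, Tendsto (fun n => X n ω) atTop (𝓝 (Y ω))) :
    ∫⁻ ω, ENNReal.ofReal (Y ω) ∂μ = ENNReal.ofReal m := by
  have hlim' : ∀ᵐ ω ∂μ, Tendsto (fun n => ENNReal.ofReal (X n ω)) atTop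
      (𝓝 (ENNReal.ofReal (Y ω))) := by
    filter_upwards [hlim] with ω hω
    exact (ENNReal.continuous_ofReal.tendsto _).comp hω
  have hm : ∀ n, Measurable fun ω => ENNReal.ofReal (X n ω) := fun n => (hX n).ennreal_ofReal
  apply le_antisymm
  · calc ∫⁻ ω, ENNReal.ofReal (Y ω) ∂μ
        = ∫⁻ ω, liminf (fun n => ENNReal.ofReal (X n ω)) atTop ∂μ :=
          lintegral_congr_ae (hlim'.mono fun ω hω => hω.liminf_eq.symm)
      _ ≤ liminf (fun n => ∫⁻ ω, ENNReal.ofReal (X n ω) ∂μ) atTop := lintegral_liminf_le hm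
      _ = ENNReal.ofReal m := by simp [hmean]
  · -- truncate at level `M`: the remainder has mean at most `K / M`
    have htrunc : ∀ M : ℕ, 0 < M → ENNReal.ofReal m ≤
        ∫⁻ ω, ENNReal.ofReal (Y ω) ∂μ + ENNReal.ofReal K * (M : ℝ≥0∞)⁻¹ := by
      intro M hM
      have hM' : (0 : ℝ) < M := by exact_mod_cast hM
      have hle : ∀ n, ENNReal.ofReal m ≤
          ∫⁻ ω, min (ENNReal.ofReal (X n ω)) M ∂μ + ENNReal.ofReal K * (M : ℝ≥0∞)⁻¹ := by
        intro n
        rw [← hmean n]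
        calc ∫⁻ ω, ENNReal.ofReal (X n ω) ∂μ
            ≤ ∫⁻ ω, (min (ENNReal.ofReal (X n ω)) M +
                ENNReal.ofReal (X n ω ^ 2) * (M : ℝ≥0∞)⁻¹) ∂μ := by
              refine lintegral_mono fun ω => ?_
              rcases le_total (ENNReal.ofReal (X n ω)) M with h | h
              · rw [min_eq_left h]
                exact le_self_add
              · refine le_add_left ?_
                rw [← div_eq_mul_inv, ENNReal.le_div_iff_mul_le (by simp [hM.ne']) (by simp),
                  pow_two, ENNReal.ofReal_mul (hX0 n ω)]
                gcongr
          _ = _ := by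
              rw [lintegral_add_left ((hm n).min measurable_const),
                lintegral_mul_const _ ((hX n).pow_const 2).ennreal_ofReal]
          _ ≤ _ := by
              gcongr
              exact hsq n
      have hdom : Tendsto (fun n => ∫⁻ ω, min (ENNReal.ofReal (X n ω)) M ∂μ) atTop
          (𝓝 (∫⁻ ω, min (ENNReal.ofReal (Y ω)) M ∂μ)) := by
        refine tendsto_lintegral_of_dominated_convergence (fun _ => (M : ℝ≥0∞))
          (fun n => (hm n).min measurable_const) (fun n => ae_of_all _ fun ω => min_le_right _ _)
          (by simp) ?_
        filter_upwards [hlim'] with ω hω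
        exact hω.min tendsto_const_nhds
      refine (ge_of_tendsto (hdom.add_const _) (Eventually.of_forall hle)).trans ?_
      gcongr
      exact min_le_left _ _
    have hz : Tendsto (fun M : ℕ => ∫⁻ ω, ENNReal.ofReal (Y ω) ∂μ +
        ENNReal.ofReal K * (M : ℝ≥0∞)⁻¹) atTop (𝓝 (∫⁻ ω, ENNReal.ofReal (Y ω) ∂μ)) := by
      have := (ENNReal.Tendsto.const_mul (a := ENNReal.ofReal K) ENNReal.tendsto_inv_nat_nhds_zero
        (Or.inr ENNReal.ofReal_ne_top)).const_add (∫⁻ ω, ENNReal.ofReal (Y ω) ∂μ)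
      simpa using this
    exact ge_of_tendsto hz ((eventually_gt_atTop 0).mono htrunc)

lemma tendsto_blockSize_atTop {t : ℝ} {x : MarkedTree} {b : ℕ} {W : ℝ} (hW : 0 < W)
    (h : Tendsto (fun n : ℕ => (n : ℝ) ^ (-Real.exp (-t)) * blockSize t x b n) atTop (𝓝 W)) :
    Tendsto (fun n => blockSize t x b n) atTop atTop := by
  have h1 : Tendsto (fun n : ℕ => (n : ℝ) ^ (Real.exp (-t))) atTop atTop :=
    (tendsto_rpow_atTop (Real.exp_pos _)).comp tendsto_natCast_atTop_atTop
  rw [← tendsto_natCast_atTop_iff (R := ℝ)]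
  refine (h1.atTop_mul_pos hW h).congr' ?_
  filter_upwards [eventually_gt_atTop 0] with n hn
  have : (0 : ℝ) < n := by exact_mod_cast hn
  rw [← mul_assoc, ← Real.rpow_add this]
  simp

lemma lintegral_rootWeight_rpow {t : ℝ} (ht : 0 ≤ t) {q : ℝ} (hq : 0 < q) (b : ℕ) :
    ∫⁻ x, {x | blockRoot t x b = b}.indicator
        (fun x => ENNReal.ofReal (rootWeight t x b ^ q)) x ∂treeLaw =
      ENNReal.ofReal ((if b = 0 then 1 else 1 - Real.exp (-t)) *
        (risingRatio (Real.exp (-t) * q) (b + 1))⁻¹ *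
        (Real.Gamma (q + 1) / Real.Gamma (Real.exp (-t) * q + 1))) := by
  set c := Real.exp (-t) * q with hc
  have hc0 : 0 < c := mul_pos (Real.exp_pos _) hq
  have hGq : 0 < Real.Gamma (q + 1) := Real.Gamma_pos_of_pos (by linarith)
  have hGc : 0 < Real.Gamma (c + 1) := Real.Gamma_pos_of_pos (by linarith)
  set G := Real.Gamma (q + 1) / Real.Gamma (c + 1) with hG
  have hG0 : 0 < G := div_pos hGq hGc
  obtain ⟨C, hC⟩ := exists_risingRatio_sq_le hq.le
  have hmeanReal : ∀ (q' : ℝ) (_ : 0 < q') (n : ℕ),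
      ∫⁻ x, ENNReal.ofReal (blockMartingale t q' b n x) ∂treeLaw =
        ENNReal.ofReal (∫ x, blockMartingale t q' b 0 x ∂treeLaw) := by
    intro q' hq' n
    rw [← ofReal_integral_eq_lintegral_ofReal (integrable_blockMartingale t q' b n)
      (ae_of_all _ (blockMartingale_nonneg ht (by linarith) b n)),
      integral_blockMartingale ht (by linarith), integral_blockMartingale ht (by linarith)]
  have hlim : ∀ᵐ x ∂treeLaw, Tendsto (fun n => blockMartingale t q b n x) atTop
      (𝓝 ({x | blockRoot t x b = b}.indicator (fun x => rootWeight t x b ^ q * G⁻¹) x)) := by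
    filter_upwards [ae_tendsto_rootWeight ht] with x hx
    by_cases hb : blockRoot t x b = b
    · rw [Set.indicator_of_mem (by exact hb)]
      obtain ⟨hpos, hx⟩ := hx b hb
      replace hx : Tendsto (fun n : ℕ => (n : ℝ) ^ (-Real.exp (-t)) * blockSize t x b n) atTop
        (𝓝 (rootWeight t x b)) := hx.congr fun n => scaledCount_block t x b n
      have h1 := (tendsto_risingRatio (q := q) (by linarith)).comp (tendsto_blockSize_atTop hpos hx)
      have h2 := (tendsto_risingRatio (q := c) (by linarith)).inv₀ (inv_ne_zero hGc.ne')
      have h3 := (h1.mul (hx.rpow_const (p := q) (Or.inl hpos.ne'))).mul h2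
      have h4 : (Real.Gamma (q + 1))⁻¹ * rootWeight t x b ^ q * (Real.Gamma (c + 1))⁻¹⁻¹ =
          rootWeight t x b ^ q * G⁻¹ := by
        rw [hG]
        field_simp
      rw [h4, ← tendsto_add_atTop_iff_nat (b + 1)] at h3
      refine h3.congr fun n => ?_
      simp only [Function.comp_def]
      rw [blockMartingale, show n + (b + 1) = b + n + 1 by ring]
      set N := blockSize t x b (b + n + 1) with hN
      have hN0 : (0 : ℝ) < N := by exact_mod_cast blockSize_pos hb (by omega)
      have hn0 : (0 : ℝ) < ((b + n + 1 : ℕ) : ℝ) := by positivity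
      have hr := risingRatio_pos (q := c) (by linarith) (Nat.succ_ne_zero (b + n))
      rw [Real.mul_rpow (by positivity) hN0.le, ← Real.rpow_mul hn0.le, neg_mul, ← hc,
        Real.rpow_neg hN0.le]
      have h5 : (0 : ℝ) < (N : ℝ) ^ q := by positivity
      have h6 : (0 : ℝ) < ((b + n + 1 : ℕ) : ℝ) ^ (-c) := by positivity
      simp only [Nat.succ_eq_add_one] at hr
      field_simp
    · rw [Set.indicator_of_notMem (by exact hb)]
      refine tendsto_const_nhds.congr fun n => ?_
      rw [blockMartingale, blockSize_eq_zero hb, risingRatio_zero, zero_div]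
  have hfin := lintegral_eq_of_ae_tendsto_of_sq_bounded
    (K := C * ∫ x, blockMartingale t (2 * q) b 0 x ∂treeLaw)
    (measurable_blockMartingale t q b) (blockMartingale_nonneg ht (by linarith) b)
    (hmeanReal q hq) (fun n => ?_) hlim
  · rw [integral_blockMartingale ht (by linarith), ← hc] at hfin
    have h1 : ∀ x, {x | blockRoot t x b = b}.indicator
        (fun x => ENNReal.ofReal (rootWeight t x b ^ q)) x = ENNReal.ofReal ({x | blockRoot t x b = b}.indicator
        (fun x => rootWeight t x b ^ q * G⁻¹) x) * ENNReal.ofReal G := by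
      intro x
      by_cases hb : blockRoot t x b = b
      · rw [Set.indicator_of_mem (by exact hb), Set.indicator_of_mem (by exact hb),
          ← ENNReal.ofReal_mul' hG0.le, inv_mul_cancel_right₀ hG0.ne']
      · rw [Set.indicator_of_notMem (by exact hb), Set.indicator_of_notMem (by exact hb)]
        simp
    simp_rw [h1]
    rw [lintegral_mul_const, hfin, ← ENNReal.ofReal_mul' hG0.le, div_eq_mul_inv]
    exact ((((measurable_rootWeight t b).pow_const q).mul_const _).indicator
      (measurableSet_blockRoot_eq t b b)).ennreal_ofReal
  · have hC0 : 0 ≤ C := by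
      have := hC 1
      simp only [risingRatio_one] at this
      linarith
    rw [ENNReal.ofReal_mul hC0, ← hmeanReal (2 * q) (by linarith) n,
      ← lintegral_const_mul _ (measurable_blockMartingale t (2 * q) b n).ennreal_ofReal]
    refine lintegral_mono fun x => ?_
    rw [← ENNReal.ofReal_mul hC0]
    refine ENNReal.ofReal_le_ofReal ?_
    rw [blockMartingale, blockMartingale, div_pow, ← mul_div_assoc]
    refine div_le_div₀ ?_ (hC _) ?_ ?_
    · exact mul_nonneg hC0 (risingRatio_nonneg (by linarith) _)
    · rw [show Real.exp (-t) * (2 * q) = 2 * c by rw [hc]; ring]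
      exact risingRatio_pos (by linarith) (Nat.succ_ne_zero _)
    · rw [show Real.exp (-t) * (2 * q) = 2 * c by rw [hc]; ring]
      exact risingRatio_two_mul_le hc0.le _

/-! ### The mean intensity -/

lemma lintegral_exp_treeLogWeights {t : ℝ} (ht : 0 ≤ t) {q : ℝ} (hq : Real.exp t < q) :
    ∫⁻ x, ∫⁻ y, ENNReal.ofReal (Real.exp (q * y)) ∂treeLogWeights t x ∂treeLaw =
      ENNReal.ofReal ((q - 1) / (Real.exp (-t) * q - 1) *
        (Real.Gamma q / Real.Gamma (Real.exp (-t) * q))) := by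
  have hq0 : 0 < q := (Real.exp_pos t).trans hq
  set p := Real.exp (-t) with hp
  have hp0 : 0 < p := Real.exp_pos _
  have hp1 : p ≤ 1 := Real.exp_le_one_iff.2 (by linarith)
  have hc : 1 < p * q := by
    have : p * Real.exp t = 1 := by rw [hp, ← Real.exp_add]; simp
    nlinarith
  have hm : Measurable fun y : ℝ => ENNReal.ofReal (Real.exp (q * y)) := by fun_prop
  simp_rw [lintegral_treeLogWeights t _ hm]
  have hmeas : ∀ b, AEMeasurable ({x | blockRoot t x b = b}.indicator
      fun x => ENNReal.ofReal (Real.exp (q * Real.log (rootWeight t x b)))) treeLaw := fun b =>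
    ((hm.comp (Real.measurable_log.comp (measurable_rootWeight t b))).indicator
      (measurableSet_blockRoot_eq t b b)).aemeasurable
  rw [lintegral_tsum hmeas]
  have hterm : ∀ b, ∫⁻ x, {x | blockRoot t x b = b}.indicator
      (fun x => ENNReal.ofReal (Real.exp (q * Real.log (rootWeight t x b)))) x ∂treeLaw =
      ENNReal.ofReal ((if b = 0 then 1 else 1 - p) * (risingRatio (p * q) (b + 1))⁻¹ *
        (Real.Gamma (q + 1) / Real.Gamma (p * q + 1))) := by
    intro b
    rw [← lintegral_rootWeight_rpow ht hq0 b]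
    refine lintegral_congr_ae ?_
    filter_upwards [ae_tendsto_rootWeight ht] with x hx
    by_cases hb : blockRoot t x b = b
    · rw [Set.indicator_of_mem (by exact hb), Set.indicator_of_mem (by exact hb),
        Real.rpow_def_of_pos (hx b hb).1, mul_comm]
    · rw [Set.indicator_of_notMem (by exact hb), Set.indicator_of_notMem (by exact hb)]
  have hG0 : 0 < Real.Gamma (p * q + 1) := Real.Gamma_pos_of_pos (by linarith)
  have hG1 : 0 < Real.Gamma (q + 1) := Real.Gamma_pos_of_pos (by linarith)
  have hG2 : 0 < Real.Gamma (p * q) := Real.Gamma_pos_of_pos (by linarith)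
  have hsum : HasSum (fun b : ℕ => (if b = 0 then 1 else 1 - p) * (risingRatio (p * q) (b + 1))⁻¹ *
      (Real.Gamma (q + 1) / Real.Gamma (p * q + 1)))
      ((q - 1) / (p * q - 1) * (Real.Gamma q / Real.Gamma (p * q))) := by
    have h1 := ((hasSum_inv_risingRatio hc).mul_left (1 - p)).mul_right
      (Real.Gamma (q + 1) / Real.Gamma (p * q + 1))
    rw [← hasSum_nat_add_iff' 1]
    simp only [Nat.add_eq_zero_iff, one_ne_zero, and_false, if_false, Finset.range_one,
      Finset.sum_singleton, if_true, zero_add, risingRatio_one]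
    have hval : (q - 1) / (p * q - 1) * (Real.Gamma q / Real.Gamma (p * q)) -
        1 * 1⁻¹ * (Real.Gamma (q + 1) / Real.Gamma (p * q + 1)) =
        (1 - p) * (p * q - 1)⁻¹ * (Real.Gamma (q + 1) / Real.Gamma (p * q + 1)) := by
      rw [Real.Gamma_add_one hq0.ne', Real.Gamma_add_one (by positivity)]
      obtain ⟨d, hd⟩ : ∃ d, d = p * q - 1 := ⟨_, rfl⟩
      have hd0 : d ≠ 0 := by linarith
      rw [← hd]
      field_simp
      rw [hd]
      ring
    rw [hval]
    exact h1
  simp_rw [hterm]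
  rw [← ENNReal.ofReal_tsum_of_nonneg ?_ hsum.summable, hsum.tsum_eq]
  intro b
  refine mul_nonneg (mul_nonneg ?_ (inv_nonneg.2 (risingRatio_nonneg (by linarith) _))) (by positivity)
  split_ifs <;> linarith

/-- A measure on the line is determined by its exponential moments of large order. -/
lemma measure_ext_of_lintegral_exp {m₁ m₂ : Measure ℝ} {a : ℝ}
    (hfin : ∀ q, a < q → ∫⁻ y, ENNReal.ofReal (Real.exp (q * y)) ∂m₁ ≠ ∞)
    (heq : ∀ q, a < q → ∫⁻ y, ENNReal.ofReal (Real.exp (q * y)) ∂m₁ =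
      ∫⁻ y, ENNReal.ofReal (Real.exp (q * y)) ∂m₂) :
    m₁ = m₂ := by
  set d : ℝ → ℝ≥0∞ := fun y => ENNReal.ofReal (Real.exp ((a + 1) * y)) with hd
  have hdm : Measurable d := by fun_prop
  have hmul : ∀ (m : Measure ℝ) (u : ℝ), ∫⁻ y, ENNReal.ofReal (Real.exp (u * y)) ∂m.withDensity d =
      ∫⁻ y, ENNReal.ofReal (Real.exp ((a + 1 + u) * y)) ∂m := by
    intro m u
    rw [lintegral_withDensity_eq_lintegral_mul _ hdm (by fun_prop)]
    refine lintegral_congr fun y => ?_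
    rw [Pi.mul_apply, hd, ← ENNReal.ofReal_mul (Real.exp_pos _).le, ← Real.exp_add]
    ring_nf
  have hfin' : ∀ u, -1 < u → ∫⁻ y, ENNReal.ofReal (Real.exp (u * y)) ∂m₁.withDensity d ≠ ∞ :=
    fun u hu => by rw [hmul]; exact hfin _ (by linarith)
  have heq' : ∀ u, -1 < u → ∫⁻ y, ENNReal.ofReal (Real.exp (u * y)) ∂m₁.withDensity d =
      ∫⁻ y, ENNReal.ofReal (Real.exp (u * y)) ∂m₂.withDensity d :=
    fun u hu => by rw [hmul, hmul]; exact heq _ (by linarith)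
  have hfin₂ : ∀ u, -1 < u → ∫⁻ y, ENNReal.ofReal (Real.exp (u * y)) ∂m₂.withDensity d ≠ ∞ :=
    fun u hu => by rw [← heq' u hu]; exact hfin' u hu
  have hF : ∀ m : Measure ℝ, ∫⁻ y, ENNReal.ofReal (Real.exp (0 * y)) ∂m ≠ ∞ → IsFiniteMeasure m := by
    intro m h
    refine ⟨lt_top_iff_ne_top.2 ?_⟩
    simpa using h
  have := hF _ (hfin' 0 (by norm_num))
  have := hF _ (hfin₂ 0 (by norm_num))
  have hI : ∀ m : Measure ℝ, (∀ u, -1 < u → ∫⁻ y, ENNReal.ofReal (Real.exp (u * y)) ∂m ≠ ∞) →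
      Set.Ioi (-1) ⊆ interior (integrableExpSet id m) := by
    intro m h
    refine interior_maximal (fun u hu => ?_) isOpen_Ioi
    refine ⟨(by fun_prop : Measurable fun y : ℝ => Real.exp (u * id y)).aestronglyMeasurable, ?_⟩
    rw [hasFiniteIntegral_iff_ofReal (ae_of_all _ fun y => (Real.exp_pos _).le)]
    exact lt_top_iff_ne_top.2 (h u hu)
  have hmgf : ∀ u, -1 < u → mgf id (m₁.withDensity d) u = mgf id (m₂.withDensity d) u := by
    intro u hu
    rw [mgf, mgf, integral_eq_lintegral_of_nonneg_ae (ae_of_all _ fun y => (Real.exp_pos _).le)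
      (by fun_prop), integral_eq_lintegral_of_nonneg_ae (ae_of_all _ fun y => (Real.exp_pos _).le)
      (by fun_prop)]
    exact congrArg ENNReal.toReal (heq' u hu)
  have hA : ∀ m : Measure ℝ, Set.Ioi (-1) ⊆ interior (integrableExpSet id m) →
      AnalyticOnNhd ℂ (complexMGF id m) {z | z.re ∈ Set.Ioi (-1)} := fun m h z hz =>
    analyticOnNhd_complexMGF z (h hz)
  have hstrip : Set.EqOn (complexMGF id (m₁.withDensity d)) (complexMGF id (m₂.withDensity d))
      {z | z.re ∈ Set.Ioi (-1)} := by
    refine AnalyticOnNhd.eqOn_of_preconnected_of_frequently_eq (hA _ (hI _ hfin'))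
      (hA _ (hI _ hfin₂)) ((convex_Ioi (-1)).linear_preimage Complex.reLm).isPreconnected
      (z₀ := ((0 : ℝ) : ℂ)) (by simp) ?_
    have h_real : ∃ᶠ u : ℝ in 𝓝[≠] 0, complexMGF id (m₁.withDensity d) u =
        complexMGF id (m₂.withDensity d) u := by
      refine Eventually.frequently ?_
      filter_upwards [nhdsWithin_le_nhds (Ioi_mem_nhds (show (-1 : ℝ) < 0 by norm_num))] with u hu
      rw [complexMGF_ofReal, complexMGF_ofReal, hmgf u hu]
    rw [frequently_iff_seq_forall] at h_real ⊢
    obtain ⟨xs, hx_tendsto, hx_eq⟩ := h_real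
    refine ⟨fun n => xs n, ?_, fun n => hx_eq n⟩
    rw [tendsto_nhdsWithin_iff] at hx_tendsto ⊢
    exact ⟨(Complex.continuous_ofReal.tendsto 0).comp hx_tendsto.1, by simpa using hx_tendsto.2⟩
  have htilt : m₁.withDensity d = m₂.withDensity d := by
    refine Measure.ext_of_charFun (funext fun w => ?_)
    rw [← complexMGF_id_mul_I, ← complexMGF_id_mul_I]
    exact hstrip (by simp)
  have hd0 : ∀ y, d y ≠ 0 := fun y => by simp [hd, Real.exp_pos]
  have hd1 : ∀ y, d y ≠ ∞ := fun y => ENNReal.ofReal_ne_top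
  rw [← withDensity_inv_same hdm (ae_of_all m₁ hd0) (ae_of_all m₁ hd1), htilt,
    withDensity_inv_same hdm (ae_of_all m₂ hd0) (ae_of_all m₂ hd1)]

/-- Almost surely, the blocks can be ranked by decreasing weights, since the sum of the `q`-th powers
of their weights has finite mean when `q` is large. -/
lemma ae_finite_le_log_rootWeight {t : ℝ} (ht : 0 ≤ t) : ∀ᵐ x ∂treeLaw, ∀ a : ℝ,
    {b : {b : ℕ // blockRoot t x b = b} | a ≤ Real.log (rootWeight t x b)}.Finite := by
  set q := Real.exp t + 1 with hq
  have hq0 : 0 < q := by positivity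
  have hm : Measurable fun y : ℝ => ENNReal.ofReal (Real.exp (q * y)) := by fun_prop
  have hfin : ∫⁻ x, ∫⁻ y, ENNReal.ofReal (Real.exp (q * y)) ∂treeLogWeights t x ∂treeLaw ≠ ∞ := by
    rw [lintegral_exp_treeLogWeights ht (by linarith)]
    exact ENNReal.ofReal_ne_top
  filter_upwards [ae_lt_top (measurable_lintegral_treeLogWeights t hm) hfin] with x hx a
  rw [treeLogWeights, lintegral_sum_measure] at hx
  simp_rw [lintegral_dirac' _ hm] at hx
  have h1 := ENNReal.finite_const_le_of_tsum_ne_top hx.ne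
    (ε := ENNReal.ofReal (Real.exp (q * a))) (by simp [Real.exp_pos])
  refine h1.subset fun b hb => ENNReal.ofReal_le_ofReal (Real.exp_le_exp.2 ?_)
  exact mul_le_mul_of_nonneg_left hb hq0.le

/-! ### Resampling the trees inside the blocks -/

/-- The law of a sequence of independent marked trees. -/
noncomputable def treeSeqLaw : Measure (ℕ → MarkedTree) := Measure.infinitePi fun _ => treeLaw

instance : IsProbabilityMeasure treeSeqLaw := by
  rw [treeSeqLaw]
  infer_instance

/-- One less than the number of vertices among `0, …, k` in the block with root `b` at time `s`. If the
vertex `k + 1` joins this block, then it plays in it the role of the vertex `blockIndex s x b k + 1`,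
whose edge is the one with index `blockIndex s x b k` in a marked tree. -/
noncomputable def blockIndex (s : ℝ) (x : MarkedTree) (b k : ℕ) : ℕ := blockSize s x b (k + 1) - 1

/-- The edge above `k + 1` when, in the block with root `b`, the tree is prescribed by `y`: the
vertices of the block are identified increasingly with `0, 1, 2, …`, and the removal times are
counted from `s` on. -/
noncomputable def graftEdge (s : ℝ) (x : MarkedTree) (b k : ℕ) {j : ℕ} (z : Fin (j + 1) × ℝ) :
    Fin (k + 1) × ℝ :=
  (Fin.ofNat (k + 1) (Nat.nth (fun v => blockRoot s x v = b) z.1), s + z.2)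

/-- Replace the tree that each block of `x` at time `s` carries by the marked tree `g b`, where `b`
is the root of the block. The edges removed up to time `s` are kept. -/
noncomputable def regraft (s : ℝ) (x : MarkedTree) (g : ℕ → MarkedTree) : MarkedTree := fun k =>
  if s < (x k).2 then
    graftEdge s x (blockRoot s x (x k).1) k
      (g (blockRoot s x (x k).1) (blockIndex s x (blockRoot s x (x k).1) k))
  else x k

lemma nth_eq_iff (P : ℕ → Prop) [DecidablePred P] (i v : ℕ) : Nat.nth P i = v ↔
    (P v ∧ Nat.count P v = i) ∨ (v = 0 ∧ ∀ u, ¬ (P u ∧ Nat.count P u = i)) := by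
  by_cases h : ∃ u, P u ∧ Nat.count P u = i
  · obtain ⟨u, hu, rfl⟩ := h
    rw [Nat.nth_count hu]
    constructor
    · rintro rfl
      exact Or.inl ⟨hu, rfl⟩
    · rintro (⟨hv, h⟩ | ⟨-, h⟩)
      · exact Nat.count_injective hu hv h.symm
      · exact absurd ⟨hu, rfl⟩ (h u)
  · have h0 : Nat.nth P i = 0 := by
      by_contra h0
      exact h ⟨_, Nat.nth_mem_of_ne_zero h0,
        Nat.count_nth fun hf => Nat.lt_card_toFinset_of_nth_ne_zero h0 hf⟩
    rw [h0]
    constructor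
    · rintro rfl
      exact Or.inr ⟨rfl, fun u hu => h ⟨u, hu⟩⟩
    · rintro (hv | ⟨rfl, -⟩)
      · exact absurd ⟨v, hv⟩ h
      · rfl

lemma measurable_nth_block (s : ℝ) (b i : ℕ) :
    Measurable fun x => Nat.nth (fun v => blockRoot s x v = b) i := by
  have h1 : ∀ v, MeasurableSet {x | blockRoot s x v = b ∧
      Nat.count (fun v => blockRoot s x v = b) v = i} := fun v =>
    (measurableSet_blockRoot_eq s v b).inter (measurable_blockSize s b v (measurableSet_singleton i))
  refine measurable_to_countable' fun v => ?_
  have h2 : (fun x => Nat.nth (fun v => blockRoot s x v = b) i) ⁻¹' {v} =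
      {x | blockRoot s x v = b ∧ Nat.count (fun v => blockRoot s x v = b) v = i} ∪
        ({_x | v = 0} ∩ ⋂ u, {x | blockRoot s x u = b ∧
          Nat.count (fun v => blockRoot s x v = b) u = i}ᶜ) := by
    ext x
    simp only [Set.mem_preimage, Set.mem_singleton_iff, Set.mem_union, Set.mem_inter_iff,
      Set.mem_iInter, Set.mem_compl_iff, Set.mem_ofPred_eq]
    exact nth_eq_iff _ i v
  rw [h2]
  exact (h1 v).union ((MeasurableSet.const _).inter (MeasurableSet.iInter fun u => (h1 u).compl))

lemma measurable_graftEdge (s : ℝ) (b k j : ℕ) :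
    Measurable fun p : MarkedTree × (Fin (j + 1) × ℝ) => graftEdge s p.1 b k p.2 := by
  refine Measurable.prodMk ((measurable_of_countable (Fin.ofNat (k + 1))).comp ?_)
    (measurable_const.add (by fun_prop))
  exact measurable_eval_of_countable
    (f := fun (i : Fin (j + 1)) (p : MarkedTree × (Fin (j + 1) × ℝ)) =>
      Nat.nth (fun v => blockRoot s p.1 v = b) i)
    (fun i => (measurable_nth_block s b i).comp measurable_fst) (i := fun p => p.2.1) (by fun_prop)

lemma measurable_blockIndex (s : ℝ) (b k : ℕ) : Measurable fun x => blockIndex s x b k :=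
  (measurable_of_countable fun n : ℕ => n - 1).comp (measurable_blockSize s b (k + 1))

lemma measurable_regraft (s : ℝ) :
    Measurable fun p : MarkedTree × (ℕ → MarkedTree) => regraft s p.1 p.2 := by
  refine measurable_pi_lambda _ fun k => Measurable.ite ?_ ?_ (by fun_prop)
  · exact measurableSet_lt measurable_const (by fun_prop)
  · have hb : Measurable fun p : MarkedTree × (ℕ → MarkedTree) => blockRoot s p.1 (p.1 k).1 :=
      measurable_eval_of_countable
        (f := fun (u : Fin (k + 1)) (p : MarkedTree × (ℕ → MarkedTree)) => blockRoot s p.1 u)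
        (fun u => (measurable_blockRoot s u).comp measurable_fst) (i := fun p => (p.1 k).1)
        (by fun_prop)
    refine measurable_eval_of_countable
      (f := fun b (p : MarkedTree × (ℕ → MarkedTree)) =>
        graftEdge s p.1 b k (p.2 b (blockIndex s p.1 b k))) (fun b => ?_) hb
    refine measurable_eval_of_countable
      (f := fun j (p : MarkedTree × (ℕ → MarkedTree)) => graftEdge s p.1 b k (p.2 b j))
      (fun j => ?_) ((measurable_blockIndex s b k).comp measurable_fst)
    exact (measurable_graftEdge s b k j).comp (measurable_fst.prodMk (by fun_prop))

lemma blockIndex_add_one (s : ℝ) (x : MarkedTree) (k : ℕ) (u : Fin (k + 1)) :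
    blockIndex s x (blockRoot s x u) k + 1 = blockSize s x (blockRoot s x u) (k + 1) := by
  refine Nat.sub_add_cancel ?_
  rw [Nat.one_le_iff_ne_zero, blockSize, Nat.count_ne_iff_exists]
  exact ⟨u, u.2, rfl⟩

/-- Different edges are prescribed by different edges of the family of marked trees. -/
lemma injective_slot (s : ℝ) (x : MarkedTree) :
    Function.Injective fun k : {k : ℕ // s < (x k).2} =>
      (blockRoot s x (x k).1, blockIndex s x (blockRoot s x (x k).1) k) := by
  rintro ⟨k, hk⟩ ⟨l, hl⟩ h
  simp only [Prod.mk.injEq] at h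
  obtain ⟨h1, h2⟩ := h
  have h3 := blockIndex_add_one s x k (x k).1
  have h4 := blockIndex_add_one s x l (x l).1
  rw [h2, h1, h4, ← h1] at h3
  have hk' : blockRoot s x (k + 1) = blockRoot s x (x k).1 := by rw [blockRoot_succ, if_pos hk]
  have hl' : blockRoot s x (l + 1) = blockRoot s x (x k).1 := by rw [blockRoot_succ, if_pos hl, h1]
  have := Nat.count_injective (p := fun v => blockRoot s x v = blockRoot s x (x k).1) hl' hk' h3
  exact Subtype.ext (by simpa using this.symm)

/-- For a fixed tree `x`, the edges of the regrafted tree are independent. -/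
lemma treeSeqLaw_regraft_box (s : ℝ) (x : MarkedTree) (n : ℕ)
    {A : (k : ℕ) → Set (Fin (k + 1) × ℝ)} (hA : ∀ k, MeasurableSet (A k)) :
    treeSeqLaw {g | ∀ k < n, regraft s x g k ∈ A k} =
      ∏ k ∈ Finset.range n, treeSeqLaw {g | regraft s x g k ∈ A k} := by
  have hcoord : iIndepFun (fun (p : ℕ × ℕ) (g : ℕ → MarkedTree) => g p.1 p.2) treeSeqLaw :=
    iIndepFun_uncurry_infinitePi' (X := fun _ _ z => z) (fun _ k => edgeLaw k)
      (fun _ _ => measurable_id)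
  have hind : iIndepFun (fun (k : {k : ℕ // s < (x k).2}) g => regraft s x g k) treeSeqLaw := by
    have h1 := (hcoord.precomp (injective_slot s x)).comp
      (fun k z => graftEdge s x (blockRoot s x (x k).1) k z)
      (fun k => (measurable_graftEdge s _ k _).comp measurable_prodMk_left)
    refine h1.congr fun k => ae_of_all _ fun g => ?_
    simp only [regraft, if_pos k.2, Function.comp_def]
  by_cases hx : ∀ k < n, ¬ s < (x k).2 → x k ∈ A k
  · have h1 : {g | ∀ k < n, regraft s x g k ∈ A k} =
        ⋂ k ∈ (Finset.range n).subtype (fun k => s < (x k).2),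
          (fun g => regraft s x g k) ⁻¹' A k := by
      ext g
      simp only [Set.mem_ofPred_eq, Set.mem_iInter, Finset.mem_subtype, Finset.mem_range,
        Set.mem_preimage]
      constructor
      · exact fun h k hk => h k hk
      · intro h k hk
        by_cases hs : s < (x k).2
        · exact h ⟨k, hs⟩ hk
        · rw [regraft, if_neg hs]
          exact hx k hk hs
    rw [h1, hind.measure_inter_preimage_eq_mul _ fun k _ => hA k]
    refine (Finset.prod_subtype_eq_prod_filter (s := Finset.range n) (p := fun k => s < (x k).2)
      (fun k => treeSeqLaw {g | regraft s x g k ∈ A k})).trans ?_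
    rw [Finset.prod_filter]
    refine Finset.prod_congr rfl fun k hk => ?_
    split_ifs with hs
    · rfl
    · simp [regraft, hs, hx k (Finset.mem_range.1 hk) hs]
  · push Not at hx
    obtain ⟨k, hk, hs, hxk⟩ := hx
    have h0 : ∀ g, regraft s x g k ∉ A k := fun g => by
      rw [regraft, if_neg (not_lt.2 hs)]
      exact hxk
    rw [Finset.prod_eq_zero (Finset.mem_range.2 hk) (by simp [h0])]
    have : {g | ∀ k < n, regraft s x g k ∈ A k} = ∅ :=
      Set.eq_empty_of_forall_notMem fun g hg => h0 g (hg k hk)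
    rw [this, measure_empty]

lemma sum_range_count_nth {M : Type*} [AddCommMonoid M] (P : ℕ → Prop) [DecidablePred P]
    (f : ℕ → M) (n : ℕ) :
    ∑ i ∈ Finset.range (Nat.count P n), f (Nat.nth P i) =
      ∑ v ∈ Finset.range n, if P v then f v else 0 := by
  induction n with
  | zero => simp
  | succ n ih =>
    rw [Finset.sum_range_succ, ← ih, Nat.count_succ]
    split_ifs with h
    · rw [Finset.sum_range_succ, Nat.nth_count h]
    · rw [add_zero, add_zero]

/-- Given the block of its parent at time `s`, the regrafted parent is uniform in this block. -/
lemma treeSeqLaw_regraft (s : ℝ) (x : MarkedTree) (k : ℕ) {A : Set (Fin (k + 1) × ℝ)}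
    (hA : MeasurableSet A) :
    treeSeqLaw {g | regraft s x g k ∈ A} = if s < (x k).2 then
      (blockSize s x (blockRoot s x (x k).1) (k + 1) : ℝ≥0∞)⁻¹ *
        ∑ v ∈ Finset.range (k + 1), (if blockRoot s x v = blockRoot s x (x k).1 then
          expMeasure 1 {e | (Fin.ofNat (k + 1) v, s + e) ∈ A} else 0)
      else A.indicator (fun _ => 1) (x k) := by
  split_ifs with hs
  · set b := blockRoot s x (x k).1 with hb
    set j := blockIndex s x b k with hj
    have hj1 : j + 1 = blockSize s x b (k + 1) := blockIndex_add_one s x k (x k).1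
    have hm : MeasurableSet {z : Fin (j + 1) × ℝ | graftEdge s x b k z ∈ A} :=
      (measurable_graftEdge s b k j).comp measurable_prodMk_left hA
    have h1 : treeSeqLaw {g | regraft s x g k ∈ A} =
        edgeLaw j {z : Fin (j + 1) × ℝ | graftEdge s x b k z ∈ A} := by
      have h2 : treeSeqLaw.map (fun g => g b) = treeLaw :=
        Measure.infinitePi_map_eval (fun _ : ℕ => treeLaw) b
      rw [← treeLaw_coord hm, ← h2, Measure.map_apply (measurable_pi_apply b)
        ((measurable_pi_apply j) hm)]
      congr 1
      ext g
      simp only [regraft, if_pos hs, Set.mem_ofPred_eq, Set.mem_preimage]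
      rfl
    rw [h1, edgeLaw_apply j hm, ← sum_range_count_nth (fun v => blockRoot s x v = b)
      (fun v => expMeasure 1 {e | (Fin.ofNat (k + 1) v, s + e) ∈ A})]
    have h3 : ((j : ℝ≥0∞) + 1) = (blockSize s x b (k + 1) : ℝ≥0∞) := by
      rw [← hj1]
      push_cast
      rfl
    rw [h3]
    congr 1
    have h4 : Nat.count (fun v => blockRoot s x v = b) (k + 1) = j + 1 := hj1.symm
    rw [h4, ← Fin.sum_univ_eq_sum_range]
    rfl
  · by_cases hx : x k ∈ A
    · simp [regraft, hs, hx]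
    · simp [regraft, hs, hx]

/-- Averaging over the edge above `k + 1` as well, the regrafted edge has the law of an edge. The
parent is uniform, because it is obtained from a uniform vertex by choosing a vertex uniformly in its
block; the removal time is exponential, because the exponential law is memoryless. -/
lemma lintegral_treeSeqLaw_regraft_update {s : ℝ} (hs : 0 ≤ s) (x : MarkedTree) (k : ℕ)
    {A : Set (Fin (k + 1) × ℝ)} (hA : MeasurableSet A) :
    ∫⁻ z, treeSeqLaw {g | regraft s (Function.update x k z) g k ∈ A} ∂edgeLaw k = edgeLaw k A := by
  set φ : ℕ → ℝ≥0∞ := fun v => expMeasure 1 {e | (Fin.ofNat (k + 1) v, s + e) ∈ A} with hφ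
  set c : ℕ → ℝ≥0∞ := fun u => (blockSize s x (blockRoot s x u) (k + 1) : ℝ≥0∞)⁻¹ *
    ∑ v ∈ Finset.range (k + 1), (if blockRoot s x v = blockRoot s x u then φ v else 0) with hc
  have h1 : ∀ z, treeSeqLaw {g | regraft s (Function.update x k z) g k ∈ A} =
      if s < z.2 then c z.1 else A.indicator (fun _ => 1) z := by
    intro z
    have hroot : ∀ v, v ≤ k → blockRoot s (Function.update x k z) v = blockRoot s x v :=
      fun v hv => blockRoot_congr fun l hl => Function.update_of_ne (by omega) _ _
    rw [treeSeqLaw_regraft s _ k hA, Function.update_self, hroot _ (Nat.lt_succ_iff.1 z.1.2),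
      blockSize_congr (y := x) fun l hl => Function.update_of_ne (by omega) _ _]
    refine if_congr Iff.rfl ?_ rfl
    rw [hc]
    refine congrArg _ (Finset.sum_congr rfl fun v hv => ?_)
    rw [hroot v (Nat.lt_succ_iff.1 (Finset.mem_range.1 hv))]
  have hcm : Measurable fun z : Fin (k + 1) × ℝ =>
      if s < z.2 then c z.1 else A.indicator (fun _ => 1) z :=
    Measurable.ite (measurableSet_lt measurable_const measurable_snd)
      ((measurable_of_countable fun u : Fin (k + 1) => c u).comp measurable_fst)
      (measurable_const.indicator hA)
  simp_rw [h1]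
  rw [lintegral_edgeLaw k hcm, edgeLaw_apply k hA]
  congr 1
  have h2 : ∀ u : Fin (k + 1), ∫⁻ e, (if s < e then c u else A.indicator (fun _ => 1) (u, e))
      ∂expMeasure 1 = ENNReal.ofReal (Real.exp (-s)) * c u +
        expMeasure 1 (Prod.mk u ⁻¹' A ∩ (Set.Ioi s)ᶜ) := by
    intro u
    have hAu := measurable_prodMk_left (x := u) hA
    have : ∀ e, (if s < e then c u else A.indicator (fun _ => 1) (u, e)) =
        (Set.Ioi s).indicator (fun _ => c u) e +
          (Prod.mk u ⁻¹' A ∩ (Set.Ioi s)ᶜ).indicator (fun _ => 1) e := by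
      intro e
      by_cases he : s < e
      · simp [he]
      · by_cases hue : (u, e) ∈ A <;> simp [he, hue, not_lt.1 he]
    simp_rw [this]
    rw [lintegral_add_left (measurable_const.indicator measurableSet_Ioi),
      lintegral_indicator_const measurableSet_Ioi, expMeasure_Ioi hs,
      lintegral_indicator_const (hAu.inter measurableSet_Ioi.compl), one_mul, mul_comm]
  have h3 : ∀ u : Fin (k + 1), expMeasure 1 (Prod.mk u ⁻¹' A) =
      ENNReal.ofReal (Real.exp (-s)) * φ u + expMeasure 1 (Prod.mk u ⁻¹' A ∩ (Set.Ioi s)ᶜ) := by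
    intro u
    have hAu := measurable_prodMk_left (x := u) hA
    rw [← measure_inter_add_sdiff (Prod.mk u ⁻¹' A) (measurableSet_Ioi (a := s)),
      ← Measure.restrict_apply hAu, expMeasure_restrict_Ioi hs, Measure.smul_apply,
      Measure.map_apply (by fun_prop) hAu, hφ]
    simp only [Fin.ofNat_eq_cast, Fin.cast_val_eq_self]
    rfl
  simp_rw [h2, h3]
  rw [Finset.sum_add_distrib, Finset.sum_add_distrib, ← Finset.mul_sum, ← Finset.mul_sum]
  congr 2
  rw [Fin.sum_univ_eq_sum_range c, Fin.sum_univ_eq_sum_range φ, hc]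
  simp_rw [Finset.mul_sum]
  rw [Finset.sum_comm]
  refine Finset.sum_congr rfl fun v hv => ?_
  have hsize := blockIndex_add_one s x k ⟨v, Finset.mem_range.1 hv⟩
  simp only at hsize
  have h4 : ∀ u ∈ Finset.range (k + 1), (blockSize s x (blockRoot s x u) (k + 1) : ℝ≥0∞)⁻¹ *
      (if blockRoot s x v = blockRoot s x u then φ v else 0) =
      if blockRoot s x u = blockRoot s x v then
        (blockSize s x (blockRoot s x v) (k + 1) : ℝ≥0∞)⁻¹ * φ v else 0 := by
    intro u _
    by_cases h : blockRoot s x u = blockRoot s x v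
    · rw [if_pos h, if_pos h.symm, h]
    · rw [if_neg h, if_neg (Ne.symm h), mul_zero]
  rw [Finset.sum_congr rfl h4, ← Finset.sum_filter, Finset.sum_const,
    ← Nat.count_eq_card_filter_range]
  change blockSize s x (blockRoot s x v) (k + 1) • _ = _
  rw [nsmul_eq_mul, ← mul_assoc, ENNReal.mul_inv_cancel, one_mul]
  · exact_mod_cast (by omega : blockSize s x (blockRoot s x v) (k + 1) ≠ 0)
  · exact ENNReal.natCast_ne_top _

lemma nth_congr_of_lt_count {P P' : ℕ → Prop} [DecidablePred P] [DecidablePred P'] {n i : ℕ}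
    (h : ∀ v < n, P v ↔ P' v) (hi : i < Nat.count P n) : Nat.nth P i = Nat.nth P' i := by
  have hfin : ∀ hf : (Set.ofPred P).Finite, i < hf.toFinset.card := fun hf =>
    hi.trans_le (Nat.count_le_card hf n)
  have hlt : Nat.nth P i < n := Nat.nth_lt_of_lt_count hi
  have hcount : Nat.count P' (Nat.nth P i) = i := by
    conv_rhs => rw [← Nat.count_nth hfin]
    rw [Nat.count_eq_card_filter_range, Nat.count_eq_card_filter_range]
    congr 1
    exact Finset.filter_congr fun v hv => (h v ((Finset.mem_range.1 hv).trans hlt)).symm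
  have := Nat.nth_count ((h _ hlt).1 (Nat.nth_mem i hfin))
  rw [hcount] at this
  exact this.symm

/-- The regrafted edges up to some vertex depend on the edges up to this vertex only. -/
lemma regraft_congr {s : ℝ} {x y : MarkedTree} {g : ℕ → MarkedTree} {k : ℕ}
    (h : ∀ l ≤ k, x l = y l) : regraft s x g k = regraft s y g k := by
  have hroot : ∀ v ≤ k, blockRoot s x v = blockRoot s y v := fun v hv =>
    blockRoot_congr fun l hl => h l (by omega)
  have hb : blockRoot s x (x k).1 = blockRoot s y (y k).1 := by
    rw [← h k le_rfl, hroot _ (Nat.lt_succ_iff.1 (x k).1.2)]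
  have hj : blockIndex s y (blockRoot s x (x k).1) k = blockIndex s x (blockRoot s x (x k).1) k := by
    rw [blockIndex, blockIndex, blockSize_congr fun l hl => (h l (by omega)).symm]
  rw [regraft, regraft, ← h k le_rfl]
  rw [← h k le_rfl] at hb
  split_ifs with hs
  · rw [graftEdge, graftEdge, ← hb, hj,
      nth_congr_of_lt_count (P' := fun v => blockRoot s y v = blockRoot s x (x k).1) (n := k + 1)]
    · intro v hv
      rw [hroot v (by omega)]
    · exact (Fin.is_lt _).trans_eq (blockIndex_add_one s x k (x k).1)
  · rfl

/-- Splitting property: replacing the trees inside the blocks at time `s` by independent ones, with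
fresh removal times, does not change the law of the marked tree. -/
lemma map_regraft {s : ℝ} (hs : 0 ≤ s) :
    (treeLaw.prod treeSeqLaw).map (fun p => regraft s p.1 p.2) = treeLaw := by
  have hbox : ∀ (n : ℕ) (A : (k : ℕ) → Set (Fin (k + 1) × ℝ)), (∀ k, MeasurableSet (A k)) →
      (treeLaw.prod treeSeqLaw).map (fun p => regraft s p.1 p.2) {y | ∀ k < n, y k ∈ A k} =
        ∏ k ∈ Finset.range n, edgeLaw k (A k) := by
    intro n A hA
    have hmk : ∀ k, Measurable fun p : MarkedTree × (ℕ → MarkedTree) => regraft s p.1 p.2 k :=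
      fun k => (measurable_pi_apply k).comp (measurable_regraft s)
    have hm1 : ∀ k, Measurable fun x => treeSeqLaw {g | regraft s x g k ∈ A k} := fun k =>
      measurable_measure_prodMk_left (hmk k (hA k))
    have hm2 : MeasurableSet {y : MarkedTree | ∀ k < n, y k ∈ A k} := by
      simp only [Set.ofPred_forall]
      exact MeasurableSet.iInter fun k => MeasurableSet.iInter fun _ => measurable_pi_apply k (hA k)
    rw [Measure.map_apply (measurable_regraft s) hm2, Measure.prod_apply (measurable_regraft s hm2)]
    have h1 : ∀ x, treeSeqLaw (Prod.mk x ⁻¹' ((fun p : MarkedTree × (ℕ → MarkedTree) =>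
        regraft s p.1 p.2) ⁻¹' {y | ∀ k < n, y k ∈ A k})) =
        ∏ k ∈ Finset.range n, treeSeqLaw {g | regraft s x g k ∈ A k} := fun x =>
      treeSeqLaw_regraft_box s x n hA
    simp_rw [h1]
    clear hm2 h1
    induction n with
    | zero => simp
    | succ n ih =>
      simp_rw [Finset.prod_range_succ]
      have h2 : ∀ x z, (∏ k ∈ Finset.range n,
          treeSeqLaw {g | regraft s (Function.update x n z) g k ∈ A k}) =
          ∏ k ∈ Finset.range n, treeSeqLaw {g | regraft s x g k ∈ A k} := by
        intro x z
        refine Finset.prod_congr rfl fun k hk => ?_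
        have hk := Finset.mem_range.1 hk
        congr 1
        ext g
        rw [Set.mem_ofPred_eq, Set.mem_ofPred_eq,
          regraft_congr (y := x) fun l hl => Function.update_of_ne (by omega) _ _]
      have hm3 : Measurable fun x => ∏ k ∈ Finset.range n, treeSeqLaw {g | regraft s x g k ∈ A k} :=
        Finset.measurable_fun_prod _ fun k _ => hm1 k
      have hm4 : Measurable fun x => (∏ k ∈ Finset.range n, treeSeqLaw {g | regraft s x g k ∈ A k}) *
          treeSeqLaw {g | regraft s x g n ∈ A n} := hm3.mul (hm1 n)
      rw [lintegral_treeLaw_update n hm4]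
      simp_rw [h2]
      have h3 : ∀ x, ∫⁻ z, (∏ k ∈ Finset.range n, treeSeqLaw {g | regraft s x g k ∈ A k}) *
          treeSeqLaw {g | regraft s (Function.update x n z) g n ∈ A n} ∂edgeLaw n =
          (∏ k ∈ Finset.range n, treeSeqLaw {g | regraft s x g k ∈ A k}) * edgeLaw n (A n) := by
        intro x
        have hm5 : Measurable fun z => treeSeqLaw {g | regraft s (Function.update x n z) g n ∈ A n} :=
          (hm1 n).comp (measurable_update x)
        rw [lintegral_const_mul _ hm5,
          lintegral_treeSeqLaw_regraft_update hs x n (hA n)]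
      simp_rw [h3]
      rw [lintegral_mul_const _ hm3, ih]
  refine Measure.eq_infinitePi edgeLaw fun S A hA => ?_
  obtain ⟨n, hn⟩ : ∃ n, S ⊆ Finset.range n := S.exists_nat_subset_range
  have h1 := hbox n (fun k => if k ∈ S then A k else Set.univ) fun k => by
    split_ifs
    · exact hA k
    · exact .univ
  have h2 : {y : MarkedTree | ∀ k < n, y k ∈ if k ∈ S then A k else Set.univ} = Set.pi S A := by
    ext y
    simp only [Set.mem_ofPred_eq, Set.mem_pi, Finset.mem_coe]
    constructor
    · intro h k hk
      simpa [hk] using h k (Finset.mem_range.1 (hn hk))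
    · intro h k _
      split_ifs with hk
      · exact h k hk
      · trivial
  rw [h2] at h1
  rw [h1, ← Finset.prod_subset hn fun k _ hk => by simp [hk]]
  exact Finset.prod_congr rfl fun k hk => by rw [if_pos hk]

/-! ### Blocks of the regrafted tree -/

lemma blockRoot_blockRoot_of_le {r s : ℝ} (h : r ≤ s) (x : MarkedTree) (v : ℕ) :
    blockRoot r x (blockRoot s x v) = blockRoot r x v := by
  induction v using Nat.strong_induction_on with
  | _ v ih =>
    cases v with
    | zero => rw [blockRoot_zero]
    | succ k =>
      rw [blockRoot_succ s]
      split_ifs with hs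
      · rw [ih _ (x k).1.2, blockRoot_succ r x k, if_pos (h.trans_lt hs)]
      · rfl

lemma lt_card_of_lt_count {P : ℕ → Prop} [DecidablePred P] {n i : ℕ} (hi : i < Nat.count P n)
    (hf : (Set.ofPred P).Finite) : i < hf.toFinset.card :=
  hi.trans_le (Nat.count_le_card hf n)

section NewParent

variable {s : ℝ} {x : MarkedTree} {k : ℕ} (u : Fin (k + 1))
  (z : Fin (blockIndex s x (blockRoot s x u) k + 1) × ℝ)

lemma lt_blockSize_of_fin : (z.1 : ℕ) < blockSize s x (blockRoot s x u) (k + 1) :=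
  z.1.2.trans_eq (blockIndex_add_one s x k u)

lemma graftEdge_fst : ((graftEdge s x (blockRoot s x u) k z).1 : ℕ) =
    Nat.nth (fun v => blockRoot s x v = blockRoot s x u) z.1 := by
  rw [graftEdge, Fin.val_ofNat]
  exact Nat.mod_eq_of_lt (Nat.nth_lt_of_lt_count (lt_blockSize_of_fin u z))

lemma blockRoot_graftEdge_fst :
    blockRoot s x (graftEdge s x (blockRoot s x u) k z).1 = blockRoot s x u := by
  rw [graftEdge_fst]
  exact Nat.nth_mem (p := fun v => blockRoot s x v = blockRoot s x u) _
    (lt_card_of_lt_count (lt_blockSize_of_fin u z))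

lemma blockSize_graftEdge_fst :
    blockSize s x (blockRoot s x u) (graftEdge s x (blockRoot s x u) k z).1 = z.1 := by
  rw [graftEdge_fst]
  exact Nat.count_nth (p := fun v => blockRoot s x v = blockRoot s x u)
    (lt_card_of_lt_count (lt_blockSize_of_fin u z))

end NewParent

/-- Regrafting at time `s` does not change the partitions up to time `s`. -/
lemma blockRoot_regraft_of_le {r s : ℝ} (h : r ≤ s) (x : MarkedTree) {g : ℕ → MarkedTree}
    (hg : ∀ b j, 0 < (g b j).2) (v : ℕ) : blockRoot r (regraft s x g) v = blockRoot r x v := by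
  induction v using Nat.strong_induction_on with
  | _ v ih =>
    cases v with
    | zero => rw [blockRoot_zero, blockRoot_zero]
    | succ k =>
      rw [blockRoot_succ, blockRoot_succ]
      by_cases hs : s < (x k).2
      · rw [if_pos (h.trans_lt hs), ih _ (regraft s x g k).1.2]
        simp only [regraft, if_pos hs]
        rw [if_pos, ← blockRoot_blockRoot_of_le h, blockRoot_graftEdge_fst,
          blockRoot_blockRoot_of_le h]
        exact h.trans_lt (lt_add_of_pos_right _ (hg _ _))
      · have : regraft s x g k = x k := if_neg hs
        rw [this, ih _ (x k).1.2]

lemma nth_blockSize (s : ℝ) (x : MarkedTree) (v : ℕ) :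
    Nat.nth (fun u => blockRoot s x u = blockRoot s x v) (blockSize s x (blockRoot s x v) v) = v :=
  Nat.nth_count (p := fun u => blockRoot s x u = blockRoot s x v) rfl

lemma blockSize_root (s : ℝ) (x : MarkedTree) (b : ℕ) : blockSize s x b b = 0 := by
  rw [blockSize, Nat.count_iff_forall_not]
  rintro v hv rfl
  exact absurd (blockRoot_le s x v) (not_le.2 hv)

/-- Inside a block of `x` at time `s`, the partition of the regrafted tree at time `s + t` is that of
the grafted tree at time `t`. -/
lemma blockRoot_regraft_add {s t : ℝ} (ht : 0 ≤ t) (x : MarkedTree) (g : ℕ → MarkedTree) (v : ℕ) :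
    blockRoot (s + t) (regraft s x g) v = Nat.nth (fun u => blockRoot s x u = blockRoot s x v)
      (blockRoot t (g (blockRoot s x v)) (blockSize s x (blockRoot s x v) v)) := by
  induction v using Nat.strong_induction_on with
  | _ v ih =>
    cases v with
    | zero =>
      have h0 : blockSize s x 0 0 = 0 := blockSize_root s x 0
      have h1 := nth_blockSize s x 0
      rw [blockRoot_zero] at h1 ⊢
      simp only [blockRoot_zero, h0] at h1 ⊢
      exact h1.symm
    | succ k =>
      by_cases hs : s < (x k).2
      · have hb : blockRoot s x (k + 1) = blockRoot s x (x k).1 := by rw [blockRoot_succ, if_pos hs]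
        have hsize := blockIndex_add_one s x k (x k).1
        have hnth := nth_blockSize s x (k + 1)
        have hlt := (regraft s x g k).1.2
        have hreg : regraft s x g k = graftEdge s x (blockRoot s x (x k).1) k
          (g (blockRoot s x (x k).1) (blockIndex s x (blockRoot s x (x k).1) k)) := if_pos hs
        rw [hb] at hnth ⊢
        rw [blockRoot_succ, ih _ hlt]
        rw [hreg, blockRoot_graftEdge_fst, blockSize_graftEdge_fst]
        rw [← hsize] at hnth ⊢
        rw [blockRoot_succ t]
        have hiff : s + t < (graftEdge s x (blockRoot s x (x k).1) k
            (g (blockRoot s x (x k).1) (blockIndex s x (blockRoot s x (x k).1) k))).2 ↔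
            t < (g (blockRoot s x (x k).1) (blockIndex s x (blockRoot s x (x k).1) k)).2 := by
          simp only [graftEdge]
          constructor <;> intro h <;> linarith
        rw [if_congr hiff rfl rfl]
        split_ifs
        · rfl
        · exact hnth.symm
      · have hreg : regraft s x g k = x k := if_neg hs
        have hb : blockRoot s x (k + 1) = k + 1 := by rw [blockRoot_succ, if_neg hs]
        have hnth := nth_blockSize s x (k + 1)
        rw [blockRoot_succ, hreg, if_neg (by linarith)]
        rw [hb, blockSize_root] at hnth
        rw [hb, blockSize_root, blockRoot_zero, hnth]

/-- All the blocks at time `t` have a weight in `(0, ∞)`. -/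
def HasWeights (t : ℝ) (x : MarkedTree) : Prop :=
  ∀ b, blockRoot t x b = b → 0 < rootWeight t x b ∧
    Tendsto (scaledCount t {v | blockRoot t x v = b}) atTop (𝓝 (rootWeight t x b))

lemma HasWeights.tendsto {t : ℝ} {x : MarkedTree} (h : HasWeights t x) {b : ℕ}
    (hb : blockRoot t x b = b) : Tendsto (fun n : ℕ => (n : ℝ) ^ (-Real.exp (-t)) *
      blockSize t x b n) atTop (𝓝 (rootWeight t x b)) :=
  (h b hb).2.congr fun n => scaledCount_block t x b n

lemma HasWeights.infinite {t : ℝ} {x : MarkedTree} (h : HasWeights t x) {b : ℕ}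
    (hb : blockRoot t x b = b) : (Set.ofPred fun v => blockRoot t x v = b).Infinite := by
  intro hf
  have h1 := tendsto_blockSize_atTop (h b hb).1 (h.tendsto hb)
  obtain ⟨n, hn⟩ := (h1.eventually_gt_atTop hf.toFinset.card).exists
  exact absurd (Nat.count_le_card hf n) (not_le.2 hn)

section Regraft

variable {s t : ℝ} {x : MarkedTree} {g : ℕ → MarkedTree} {b : ℕ}

lemma blockRoot_regraft_eq_nth_iff (ht : 0 ≤ t)
    (hinf : (Set.ofPred fun v => blockRoot s x v = b).Infinite) (i v : ℕ) :
    blockRoot (s + t) (regraft s x g) v = Nat.nth (fun u => blockRoot s x u = b) i ↔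
      blockRoot s x v = b ∧ blockRoot t (g b) (blockSize s x b v) = i := by
  rw [blockRoot_regraft_add ht]
  constructor
  · intro h
    have h1 : blockRoot s x v = b := by
      have h2 : blockRoot s x (Nat.nth (fun u => blockRoot s x u = b) i) = b :=
        Nat.nth_mem_of_infinite hinf i
      rw [← h, ← blockRoot_regraft_add ht] at h2
      rw [← h2]
      have hle : blockRoot t (g (blockRoot s x v)) (blockSize s x (blockRoot s x v) v) <
          blockSize s x (blockRoot s x v) (v + 1) := by
        refine (blockRoot_le _ _ _).trans_lt ?_
        rw [blockSize_succ, if_pos rfl]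
        exact Nat.lt_succ_self _
      rw [blockRoot_regraft_add ht]
      exact (Nat.nth_mem (p := fun u => blockRoot s x u = blockRoot s x v) _
        (lt_card_of_lt_count hle)).symm
    rw [h1] at h
    exact ⟨h1, Nat.nth_injective hinf h⟩
  · rintro ⟨h1, h2⟩
    rw [h1, h2]

lemma blockSize_regraft (ht : 0 ≤ t) (hinf : (Set.ofPred fun v => blockRoot s x v = b).Infinite)
    (i n : ℕ) : blockSize (s + t) (regraft s x g) (Nat.nth (fun u => blockRoot s x u = b) i) n =
      blockSize t (g b) i (blockSize s x b n) := by
  induction n with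
  | zero => simp [blockSize]
  | succ n ih =>
    rw [blockSize_succ, ih, blockSize_succ s x b n,
      if_congr (blockRoot_regraft_eq_nth_iff ht hinf i n) rfl rfl]
    by_cases h : blockRoot s x n = b
    · simp only [h, true_and, if_true, blockSize_succ]
    · simp [h]

/-- The roots of the blocks of the regrafted tree at time `s + t`: they correspond to the roots in
the grafted trees at time `t`. -/
noncomputable def rootEquivRegraft (ht : 0 ≤ t) (hx : HasWeights s x) :
    (Σ b : {b : ℕ // blockRoot s x b = b}, {i : ℕ // blockRoot t (g b) i = i}) ≃
      {c : ℕ // blockRoot (s + t) (regraft s x g) c = c} :=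
  Equiv.ofBijective
    (fun p => ⟨Nat.nth (fun u => blockRoot s x u = p.1) p.2, by
      have hinf := hx.infinite p.1.2
      rw [blockRoot_regraft_eq_nth_iff ht hinf]
      refine ⟨Nat.nth_mem_of_infinite hinf _, ?_⟩
      have : blockSize s x p.1 (Nat.nth (fun u => blockRoot s x u = p.1) p.2) = p.2 :=
        Nat.count_nth_of_infinite hinf _
      rw [this, p.2.2]⟩) <| by
    constructor
    · rintro ⟨⟨b, hb⟩, ⟨i, hi⟩⟩ ⟨⟨c, hc⟩, ⟨j, hj⟩⟩ h
      simp only [Subtype.mk.injEq] at h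
      have h1 : blockRoot s x (Nat.nth (fun u => blockRoot s x u = b) i) = b :=
        Nat.nth_mem_of_infinite (hx.infinite hb) i
      have h2 : blockRoot s x (Nat.nth (fun u => blockRoot s x u = c) j) = c :=
        Nat.nth_mem_of_infinite (hx.infinite hc) j
      obtain rfl : b = c := by rw [← h1, h, h2]
      obtain rfl : i = j := Nat.nth_injective (hx.infinite hb) h
      rfl
    · rintro ⟨c, hc⟩
      have hb := blockRoot_blockRoot s x c
      have hnth := nth_blockSize s x c
      refine ⟨⟨⟨blockRoot s x c, hb⟩, ⟨blockSize s x (blockRoot s x c) c, ?_⟩⟩, Subtype.ext hnth⟩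
      have h1 := hc
      conv_rhs at h1 => rw [← hnth]
      exact ((blockRoot_regraft_eq_nth_iff ht (hx.infinite hb) _ _).1 h1).2

lemma rootEquivRegraft_apply (ht : 0 ≤ t) (hx : HasWeights s x)
    (b : {b : ℕ // blockRoot s x b = b}) (i : {i : ℕ // blockRoot t (g b) i = i}) :
    (rootEquivRegraft (g := g) ht hx ⟨b, i⟩ : ℕ) = Nat.nth (fun u => blockRoot s x u = b) i := rfl

/-- A block with weight `w` at time `s`, together with a block of weight `w'` at time `t` of the tree
grafted into it, gives a block with weight `w' * w ^ (e ^ (-t))` at time `s + t`. -/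
lemma rootWeight_regraft (ht : 0 ≤ t) (hx : HasWeights s x) (hb : blockRoot s x b = b)
    (hg : HasWeights t (g b)) {i : ℕ} (hi : blockRoot t (g b) i = i) :
    rootWeight (s + t) (regraft s x g) (Nat.nth (fun u => blockRoot s x u = b) i) =
      rootWeight t (g b) i * rootWeight s x b ^ Real.exp (-t) := by
  have hinf := hx.infinite hb
  have h1 := (hg.tendsto hi).comp (tendsto_blockSize_atTop (hx b hb).1 (hx.tendsto hb))
  have h2 := (hx.tendsto hb).rpow_const (p := Real.exp (-t)) (Or.inl (hx b hb).1.ne')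
  refine Tendsto.limUnder_eq ((h1.mul h2).congr' ?_)
  filter_upwards [eventually_gt_atTop b] with n hn
  rw [scaledCount_block, blockSize_regraft ht hinf]
  simp only [Function.comp_def]
  have hN : (0 : ℝ) < blockSize s x b n := by exact_mod_cast blockSize_pos hb hn
  have hn0 : (0 : ℝ) < n := by exact_mod_cast (Nat.zero_le b).trans_lt hn
  rw [Real.mul_rpow (by positivity) hN.le, ← Real.rpow_mul hn0.le, Real.rpow_neg hN.le,
    show -Real.exp (-s) * Real.exp (-t) = -Real.exp (-(s + t)) by
      rw [neg_mul, ← Real.exp_add]; ring_nf]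
  have h3 : (0 : ℝ) < (blockSize s x b n : ℝ) ^ Real.exp (-t) := by positivity
  field_simp

/-- The branching property for the point measures of logarithms of weights. -/
lemma treeLogWeights_regraft (ht : 0 ≤ t) (hx : HasWeights s x) (hg : ∀ b, HasWeights t (g b)) :
    treeLogWeights (s + t) (regraft s x g) =
      Measure.sum fun b : {b : ℕ // blockRoot s x b = b} =>
        (treeLogWeights t (g b)).map fun z =>
          Real.exp (-t) * Real.log (rootWeight s x b) + z := by
  ext B hB
  rw [treeLogWeights, Measure.sum_apply _ hB, Measure.sum_apply _ hB,
    ← (rootEquivRegraft (g := g) ht hx).tsum_eq, ENNReal.tsum_sigma']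
  refine tsum_congr fun b => ?_
  have hm : Measurable fun z : ℝ => Real.exp (-t) * Real.log (rootWeight s x b) + z := by fun_prop
  rw [Measure.map_apply hm hB, treeLogWeights, Measure.sum_apply _ (hm hB)]
  refine tsum_congr fun i => ?_
  rw [rootEquivRegraft_apply, rootWeight_regraft ht hx b.2 (hg b) i.2,
    Real.log_mul (hg b i i.2).1.ne' (Real.rpow_pos_of_pos (hx b b.2).1 _).ne',
    Real.log_rpow (hx b b.2).1, Measure.dirac_apply' _ hB, Measure.dirac_apply' _ (hm hB), add_comm]
  rfl

end Regraft

lemma treeLogWeights_regraft_of_le {r s : ℝ} (h : r ≤ s) (x : MarkedTree) {g : ℕ → MarkedTree}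
    (hg : ∀ b j, 0 < (g b j).2) : treeLogWeights r (regraft s x g) = treeLogWeights r x := by
  have h1 : blockRoot r (regraft s x g) = blockRoot r x :=
    funext fun v => blockRoot_regraft_of_le h x hg v
  exact congrArg (fun ρ : ℕ → ℕ => Measure.sum fun b : {b : ℕ // ρ b = b} =>
    Measure.dirac (Real.log (blockWeight r {v | ρ v = b}))) h1

/-! ### Ranked atoms of a point measure -/

lemma pointMeasure_apply {ι : Type} (y : ι → ℝ) {S : Set ℝ} (hS : MeasurableSet S) :
    pointMeasure y S = ({i | y i ∈ S}.encard : ℝ≥0∞) := by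
  rw [pointMeasure, Measure.sum_apply _ hS, ← ENNReal.tsum_set_one,
    tsum_subtype {i | y i ∈ S} fun _ => (1 : ℝ≥0∞)]
  refine tsum_congr fun i => ?_
  rw [Measure.dirac_apply' _ hS]
  rfl

/-- The location of the atom of rank `k` (counted from `0`, in decreasing order) of a point
measure. -/
noncomputable def rankedAtom (k : ℕ) (m : Measure ℝ) : ℝ :=
  (⨆ q : ℚ, if (k : ℝ≥0∞) < m (Set.Ici (q : ℝ)) then ((q : ℝ) : EReal) else ⊥).toReal

lemma measurable_rankedAtom (k : ℕ) : Measurable (rankedAtom k) := by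
  refine Measurable.ereal_toReal (Measurable.iSup fun q => ?_)
  exact Measurable.ite (measurableSet_lt measurable_const
    (Measure.measurable_coe measurableSet_Ici)) measurable_const measurable_const

section Rank

variable {ι : Type} (y : ι → ℝ) (c : ι → ℕ)

/-- The indices that precede `i` when `y` is ranked in decreasing order, ties being broken by `c`. -/
def preceding (i : ι) : Set ι := {j | y i < y j ∨ (y i = y j ∧ c j < c i)}

/-- The rank of an index when `y` is ranked in decreasing order. -/
noncomputable def atomRank (i : ι) : ℕ := (preceding y c i).ncard

variable {y c}

lemma finite_preceding (hy : FiniteAbove y) (i : ι) : (preceding y c i).Finite :=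
  (hy (y i)).subset fun j hj => by
    rcases hj with h | h
    · exact h.le
    · exact h.1.le

lemma notMem_preceding_self (i : ι) : i ∉ preceding y c i := by
  rintro (h | h)
  · exact lt_irrefl _ h
  · exact lt_irrefl _ h.2

lemma preceding_trans {i j l : ι} (h : j ∈ preceding y c i) (h' : l ∈ preceding y c j) :
    l ∈ preceding y c i := by
  rcases h with h | ⟨h, h2⟩ <;> rcases h' with h' | ⟨h', h2'⟩
  · exact Or.inl (h.trans h')
  · exact Or.inl (h.trans_eq h')
  · exact Or.inl (h.trans_lt h')
  · exact Or.inr ⟨h.trans h', h2'.trans h2⟩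

lemma atomRank_lt (hy : FiniteAbove y) {i j : ι} (h : j ∈ preceding y c i) :
    atomRank y c j < atomRank y c i := by
  refine Set.ncard_lt_ncard ⟨fun l hl => preceding_trans h hl, fun hsub => ?_⟩
    (finite_preceding hy i)
  exact notMem_preceding_self j (hsub h)

lemma injective_atomRank (hy : FiniteAbove y) (hc : Function.Injective c) :
    Function.Injective (atomRank y c) := by
  intro i j hij
  by_contra hne
  have h : i ∈ preceding y c j ∨ j ∈ preceding y c i := by
    rcases lt_trichotomy (y i) (y j) with h | h | h
    · exact Or.inr (Or.inl h)
    · rcases lt_trichotomy (c i) (c j) with h' | h' | h'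
      · exact Or.inl (Or.inr ⟨h.symm, h'⟩)
      · exact absurd (hc h') hne
      · exact Or.inr (Or.inr ⟨h, h'⟩)
    · exact Or.inl (Or.inl h)
  rcases h with h | h
  · exact absurd hij (atomRank_lt hy h).ne
  · exact absurd hij (atomRank_lt hy h).ne'

/-- The ranks form an initial segment of the natural numbers. -/
lemma exists_atomRank_eq (hy : FiniteAbove y) (hc : Function.Injective c) {i : ι} {k : ℕ}
    (hk : k < atomRank y c i) : ∃ j, atomRank y c j = k := by
  have hfin := finite_preceding (c := c) hy i
  have h1 : (atomRank y c) '' preceding y c i ⊆ Set.Iio (atomRank y c i) := by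
    rintro _ ⟨j, hj, rfl⟩
    exact atomRank_lt hy hj
  have h2 : (atomRank y c) '' preceding y c i = Set.Iio (atomRank y c i) := by
    refine Set.eq_of_subset_of_ncard_le h1 ?_ (Set.finite_Iio _)
    rw [Set.ncard_image_of_injective _ (injective_atomRank hy hc), ← Finset.coe_Iio,
      Set.ncard_coe_finset, Nat.card_Iio]
    rfl
  have h3 : k ∈ (atomRank y c) '' preceding y c i := by
    rw [h2]
    exact hk
  obtain ⟨j, -, hj⟩ := h3
  exact ⟨j, hj⟩

lemma atomRank_lt_pointMeasure_Ici_iff (hy : FiniteAbove y) (i : ι) (a : ℝ) :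
    (atomRank y c i : ℝ≥0∞) < pointMeasure y (Set.Ici a) ↔ a ≤ y i := by
  have hfin : {j | y j ∈ Set.Ici a}.Finite := hy a
  rw [pointMeasure_apply _ measurableSet_Ici, ← hfin.cast_ncard_eq]
  simp only [ENat.toENNReal_coe, Nat.cast_lt]
  constructor
  · intro h
    by_contra hlt
    refine absurd h (not_lt.2 (Set.ncard_le_ncard (fun j hj => Or.inl ?_) (finite_preceding hy i)))
    exact (not_le.1 hlt).trans_le hj
  · intro h
    rw [Nat.lt_iff_add_one_le, atomRank,
      ← Set.ncard_insert_of_notMem (notMem_preceding_self i) (finite_preceding hy i)]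
    refine Set.ncard_le_ncard (fun j hj => ?_) hfin
    rcases hj with rfl | hj | hj
    · exact h
    · exact h.trans hj.le
    · exact h.trans hj.1.le

lemma rankedAtom_atomRank (hy : FiniteAbove y) (i : ι) :
    rankedAtom (atomRank y c i) (pointMeasure y) = y i := by
  have : (⨆ q : ℚ, if (atomRank y c i : ℝ≥0∞) < pointMeasure y (Set.Ici (q : ℝ)) then
      ((q : ℝ) : EReal) else ⊥) = (y i : EReal) := by
    simp only [atomRank_lt_pointMeasure_Ici_iff hy]
    apply le_antisymm
    · refine iSup_le fun q => ?_
      split_ifs with h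
      · exact EReal.coe_le_coe_iff.2 h
      · exact bot_le
    · refine le_of_forall_lt fun a ha => ?_
      obtain ⟨q, haq, hq⟩ := EReal.lt_iff_exists_rat_btwn.1 ha
      refine haq.trans_le (le_iSup_of_le q ?_)
      rw [if_pos (EReal.coe_lt_coe_iff.1 hq).le]
  rw [rankedAtom, this, EReal.toReal_coe]

lemma lt_pointMeasure_univ_iff (hy : FiniteAbove y) (hc : Function.Injective c) (k : ℕ) :
    (k : ℝ≥0∞) < pointMeasure y Set.univ ↔ k ∈ Set.range (atomRank y c) := by
  constructor
  · intro h
    by_contra hk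
    have hlt : ∀ i, atomRank y c i < k := by
      intro i
      by_contra hi
      rcases (not_lt.1 hi).lt_or_eq with h' | h'
      · exact hk (exists_atomRank_eq hy hc h')
      · exact hk ⟨i, h'.symm⟩
    have h1 : (Set.univ : Set ι).encard ≤ k := by
      rw [← (injective_atomRank hy hc).encard_image]
      refine (Set.encard_le_encard (t := (Finset.range k : Set ℕ)) ?_).trans ?_
      · rintro _ ⟨i, -, rfl⟩
        simpa using hlt i
      · rw [Set.encard_coe_eq_coe_finsetCard, Finset.card_range]
    rw [pointMeasure_apply _ .univ] at h
    simp only [Set.mem_univ, Set.ofPred_true] at h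
    have h2 : ((Set.univ : Set ι).encard : ℝ≥0∞) ≤ ((k : ℕ∞) : ℝ≥0∞) := ENat.toENNReal_le.2 h1
    exact absurd h (not_lt.2 (by simpa using h2))
  · rintro ⟨i, rfl⟩
    exact ((atomRank_lt_pointMeasure_Ici_iff hy i (y i)).2 le_rfl).trans_le
      (measure_mono (Set.subset_univ _))

end Rank

/-! ### The branching kernel -/

lemma measurable_map_treeLogWeights (t : ℝ) : Measurable fun p : ℝ × MarkedTree =>
    (treeLogWeights t p.2).map fun z => p.1 + z := by
  refine Measure.measurable_of_measurable_coe _ fun B hB => ?_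
  have h1 : ∀ p : ℝ × MarkedTree, (treeLogWeights t p.2).map (fun z => p.1 + z) B =
      ∑' b : ℕ, {p : ℝ × MarkedTree | blockRoot t p.2 b = b}.indicator
        (fun p => B.indicator 1 (p.1 + Real.log (rootWeight t p.2 b))) p := by
    intro p
    have hm : Measurable fun z : ℝ => p.1 + z := by fun_prop
    rw [Measure.map_apply hm hB, ← lintegral_indicator_one (hm hB),
      lintegral_treeLogWeights t _ (measurable_one.indicator (hm hB))]
    rfl
  simp_rw [h1]
  refine Measurable.tsum fun b => Measurable.indicator ?_
    (measurable_snd (measurableSet_blockRoot_eq t b b))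
  exact (measurable_one.indicator hB).comp (measurable_fst.add
    (Real.measurable_log.comp ((measurable_rootWeight t b).comp measurable_snd)))

/-- The superposition of the point measures of the logarithms of weights of the trees `g k` at time
`t`, translated by `e^{-t}` times the atom of rank `k` of `m`. -/
noncomputable def branchAt (t : ℝ) (m : Measure ℝ) (g : ℕ → MarkedTree) : Measure ℝ :=
  Measure.sum fun k : ℕ => if (k : ℝ≥0∞) < m Set.univ then
    (treeLogWeights t (g k)).map fun z => Real.exp (-t) * rankedAtom k m + z else 0

lemma measurable_measure_sum {α β ι : Type*} [MeasurableSpace α] [MeasurableSpace β] [Countable ι]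
    {f : ι → α → Measure β} (hf : ∀ i, Measurable (f i)) :
    Measurable fun a => Measure.sum fun i => f i a := by
  refine Measure.measurable_of_measurable_coe _ fun B hB => ?_
  simp_rw [Measure.sum_apply _ hB]
  exact Measurable.tsum fun i => (Measure.measurable_coe hB).comp (hf i)

lemma measurable_branchAt (t : ℝ) :
    Measurable fun p : Measure ℝ × (ℕ → MarkedTree) => branchAt t p.1 p.2 := by
  refine measurable_measure_sum fun k => Measurable.ite ?_ ?_ measurable_const
  · exact measurableSet_lt measurable_const
      ((Measure.measurable_coe .univ).comp measurable_fst)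
  · exact (measurable_map_treeLogWeights t).comp
      ((((measurable_rankedAtom k).comp measurable_fst).const_mul _).prodMk (by fun_prop))

/-- The transition kernel of the branching process over a time `t`. -/
noncomputable def branchingKernel (t : ℝ) : Kernel (Measure ℝ) (Measure ℝ) where
  toFun m := treeSeqLaw.map (branchAt t m)
  measurable' := by
    refine Measure.measurable_of_measurable_coe _ fun A hA => ?_
    have h1 : ∀ m, treeSeqLaw.map (branchAt t m) A =
        treeSeqLaw (Prod.mk m ⁻¹' ((fun p : Measure ℝ × (ℕ → MarkedTree) => branchAt t p.1 p.2) ⁻¹' A)) :=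
      fun m => Measure.map_apply ((measurable_branchAt t).comp measurable_prodMk_left) hA
    simp_rw [h1]
    exact measurable_measure_prodMk_left (measurable_branchAt t hA)

instance (t : ℝ) : IsMarkovKernel (branchingKernel t) :=
  ⟨fun _ => Measure.isProbabilityMeasure_map
    ((measurable_branchAt t).comp measurable_prodMk_left).aemeasurable⟩

lemma branchAt_pointMeasure {ι : Type} {y : ι → ℝ} {c : ι → ℕ} (hy : FiniteAbove y)
    (hc : Function.Injective c) (t : ℝ) (g : ℕ → MarkedTree) :
    branchAt t (pointMeasure y) g = Measure.sum fun i =>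
      (treeLogWeights t (g (atomRank y c i))).map fun z => Real.exp (-t) * y i + z := by
  ext B hB
  rw [branchAt, Measure.sum_apply _ hB, Measure.sum_apply _ hB,
    ← (injective_atomRank hy hc).tsum_eq]
  · refine tsum_congr fun i => ?_
    rw [if_pos ((lt_pointMeasure_univ_iff hy hc _).2 ⟨i, rfl⟩), rankedAtom_atomRank hy]
  · intro k hk
    rw [← lt_pointMeasure_univ_iff hy hc]
    by_contra h
    exact hk (by simp [h])

lemma map_treeSeqLaw_comp {ι : Type} {f : ι → ℕ} (hf : Function.Injective f) (t : ℝ) :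
    treeSeqLaw.map (fun g i => treeLogWeights t (g (f i))) =
      Measure.infinitePi fun _ : ι => treeLaw.map (treeLogWeights t) := by
  rw [← Measure.infinitePi_map_pi (fun _ : ι => treeLaw) fun _ => measurable_treeLogWeights t,
    ← Measure.map_infinitePi_infinitePi_of_inj (P := fun _ : ℕ => treeLaw) hf, Measure.map_map]
  · rfl
  · exact measurable_pi_lambda _ fun i => (measurable_treeLogWeights t).comp (measurable_pi_apply i)
  · fun_prop

lemma map_treeSeqLaw_sum {ι : Type} [Countable ι] {f : ι → ℕ} (hf : Function.Injective f) (t : ℝ)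
    (y : ι → ℝ) : treeSeqLaw.map (fun g => Measure.sum fun i =>
      (treeLogWeights t (g (f i))).map fun z => Real.exp (-t) * y i + z) =
      ouSuperpositionLaw (treeLaw.map (treeLogWeights t)) t y := by
  rw [ouSuperpositionLaw, ← map_treeSeqLaw_comp hf, Measure.map_map]
  · rfl
  · exact measurable_measure_sum fun i =>
      (Measure.measurable_map _ (by fun_prop)).comp (measurable_pi_apply i)
  · exact measurable_pi_lambda _ fun i => (measurable_treeLogWeights t).comp (measurable_pi_apply _)

lemma branchingKernel_pointMeasure {ι : Type} [Countable ι] {y : ι → ℝ} (hy : FiniteAbove y)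
    (t : ℝ) : branchingKernel t (pointMeasure y) =
      ouSuperpositionLaw (treeLaw.map (treeLogWeights t)) t y := by
  obtain ⟨c, hc⟩ := exists_injective_nat ι
  rw [← map_treeSeqLaw_sum (injective_atomRank hy hc)]
  change treeSeqLaw.map (branchAt t (pointMeasure y)) = _
  congr 1
  exact funext fun g => branchAt_pointMeasure hy hc t g

/-! ### The Markov property -/

/-- Two outcomes that give the same trajectory up to time `s` belong to the same events of the past
of `s`. -/
lemma mem_iff_of_measurableSet_pastSigma {Ω : Type*} {Y : ℝ → Ω → Measure ℝ} {s : ℝ} {B : Set Ω}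
    (hB : MeasurableSet[pastSigma Y s] B) {ω ω' : Ω} (h : ∀ r ∈ Set.Icc 0 s, Y r ω = Y r ω') :
    ω ∈ B ↔ ω' ∈ B := by
  let f : Bool → Ω := fun i => if i then ω else ω'
  -- the events that do not separate the two outcomes form a `σ`-algebra
  have hle : pastSigma Y s ≤ MeasurableSpace.map f ⊥ := by
    refine iSup₂_le fun r hr => ?_
    rintro _ ⟨S, -, rfl⟩
    rw [MeasurableSpace.map_def, MeasurableSpace.measurableSet_bot_iff]
    by_cases hS : Y r ω ∈ S
    · refine Or.inr (Set.eq_univ_of_forall fun i => ?_)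
      cases i
      · change Y r ω' ∈ S
        rwa [← h r hr]
      · exact hS
    · refine Or.inl (Set.eq_empty_of_forall_notMem fun i hi => hS ?_)
      cases i
      · change Y r ω' ∈ S at hi
        rwa [h r hr]
      · exact hi
  have hf := hle B hB
  rw [MeasurableSpace.map_def, MeasurableSpace.measurableSet_bot_iff] at hf
  rcases hf with hf | hf
  · have h1 : ∀ i, f i ∉ B := fun i hi => by
      have : i ∈ f ⁻¹' B := hi
      rw [hf] at this
      exact this
    exact iff_of_false (h1 true) (h1 false)
  · have h1 : ∀ i, f i ∈ B := fun i => by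
      have : i ∈ f ⁻¹' B := by rw [hf]; trivial
      exact this
    exact iff_of_true (h1 true) (h1 false)

lemma pastSigma_le {Ω : Type*} [mΩ : MeasurableSpace Ω] {Y : ℝ → Ω → Measure ℝ}
    (hY : ∀ r, 0 ≤ r → Measurable (Y r)) (s : ℝ) : pastSigma Y s ≤ mΩ :=
  iSup₂_le fun r hr => (hY r hr.1).comap_le

lemma ae_treeSeqLaw {p : MarkedTree → Prop} (h : ∀ᵐ x ∂treeLaw, p x) :
    ∀ᵐ g ∂treeSeqLaw, ∀ b, p (g b) := by
  rw [ae_all_iff]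
  intro b
  rw [← Measure.infinitePi_map_eval (fun _ : ℕ => treeLaw) b] at h
  exact ae_of_ae_map (measurable_pi_apply b).aemeasurable h

/-- The Markov property of the point measures of logarithms of weights, obtained by resampling the
trees inside the blocks at time `s`. -/
lemma treeLaw_inter_preimage {s t : ℝ} (hs : 0 ≤ s) (ht : 0 ≤ t) {A : Set (Measure ℝ)}
    (hA : MeasurableSet A) {B : Set MarkedTree} (hB : MeasurableSet[pastSigma treeLogWeights s] B) :
    treeLaw (B ∩ treeLogWeights (s + t) ⁻¹' A) =
      ∫⁻ x in B, branchingKernel t (treeLogWeights s x) A ∂treeLaw := by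
  have hBm : MeasurableSet B := pastSigma_le (fun r _ => measurable_treeLogWeights r) s B hB
  have hm := measurable_regraft s
  have hBA := hBm.inter (measurable_treeLogWeights (s + t) hA)
  conv_lhs => rw [← map_regraft hs]
  rw [Measure.map_apply hm hBA, Measure.prod_apply (hm hBA), ← lintegral_indicator hBm]
  refine lintegral_congr_ae ?_
  filter_upwards [ae_tendsto_rootWeight hs, ae_finite_le_log_rootWeight hs] with x hx hfin
  have hweights : HasWeights s x := hx
  have hlaw : branchingKernel t (treeLogWeights s x) =
      treeSeqLaw.map fun g => Measure.sum fun b : {b : ℕ // blockRoot s x b = b} =>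
        (treeLogWeights t (g b)).map fun z =>
          Real.exp (-t) * Real.log (rootWeight s x b) + z := by
    rw [map_treeSeqLaw_sum (f := fun b : {b : ℕ // blockRoot s x b = b} => (b : ℕ))
      Subtype.val_injective]
    exact branchingKernel_pointMeasure
      (y := fun b : {b : ℕ // blockRoot s x b = b} => Real.log (rootWeight s x b)) hfin t
  have hsum : Measurable fun g : ℕ → MarkedTree =>
      Measure.sum fun b : {b : ℕ // blockRoot s x b = b} => (treeLogWeights t (g b)).map fun z =>
        Real.exp (-t) * Real.log (rootWeight s x b) + z :=
    measurable_measure_sum fun b => (Measure.measurable_map _ (by fun_prop)).comp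
      ((measurable_treeLogWeights t).comp (measurable_pi_apply _))
  have hmem : ∀ᵐ g ∂treeSeqLaw, (regraft s x g ∈ B ↔ x ∈ B) := by
    filter_upwards [ae_treeSeqLaw ae_treeLaw_pos] with g hg
    exact mem_iff_of_measurableSet_pastSigma hB
      fun r hr => treeLogWeights_regraft_of_le hr.2 x hg
  by_cases hxB : x ∈ B
  · rw [Set.indicator_of_mem hxB, hlaw, Measure.map_apply hsum hA]
    refine measure_congr ?_
    filter_upwards [hmem, ae_treeSeqLaw (ae_tendsto_rootWeight ht)] with g hg hw
    have hreg := treeLogWeights_regraft ht hweights hw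
    refine propext ?_
    change (regraft s x g ∈ B ∧ treeLogWeights (s + t) (regraft s x g) ∈ A) ↔ _
    rw [hreg, hg]
    exact ⟨fun h => h.2, fun h => ⟨hxB, h⟩⟩
  · rw [Set.indicator_of_notMem hxB]
    refine measure_mono_null (t := {g | ¬ (regraft s x g ∈ B ↔ x ∈ B)}) (fun g hg h => ?_) hmem
    exact hxB (h.1 hg.1)

section

variable {Ω : Type*} {parent : (k : ℕ) → Ω → Fin (k + 1)} {clock : ℕ → Ω → ℝ}

lemma logWeights_eq_comp (t : ℝ) :
    logWeights parent clock t = treeLogWeights t ∘ markedTree parent clock :=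
  funext fun ω => logWeights_eq_treeLogWeights parent clock t ω

lemma pastSigma_logWeights (s : ℝ) : pastSigma (logWeights parent clock) s =
    MeasurableSpace.comap (markedTree parent clock) (pastSigma treeLogWeights s) := by
  simp only [pastSigma, MeasurableSpace.comap_iSup, MeasurableSpace.comap_comp, logWeights_eq_comp]

namespace IsRecursiveTreeWithClocks

variable [MeasurableSpace Ω] {μ : Measure Ω}

lemma ae_of_ae_treeLaw [IsProbabilityMeasure μ] (h : IsRecursiveTreeWithClocks μ parent clock)
    {p : MarkedTree → Prop} (hp : ∀ᵐ x ∂treeLaw, p x) :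
    ∀ᵐ ω ∂μ, p (markedTree parent clock ω) := by
  rw [← h.map_markedTree] at hp
  exact ae_of_ae_map h.measurable_markedTree.aemeasurable hp

lemma measurable_logWeights (h : IsRecursiveTreeWithClocks μ parent clock) (t : ℝ) :
    Measurable (logWeights parent clock t) := by
  rw [logWeights_eq_comp]
  exact (measurable_treeLogWeights t).comp h.measurable_markedTree

lemma map_logWeights [IsProbabilityMeasure μ] (h : IsRecursiveTreeWithClocks μ parent clock)
    (t : ℝ) : μ.map (logWeights parent clock t) = treeLaw.map (treeLogWeights t) := by
  rw [logWeights_eq_comp, ← h.map_markedTree,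
    Measure.map_map (measurable_treeLogWeights t) h.measurable_markedTree]

lemma lintegral_logWeights [IsProbabilityMeasure μ] (h : IsRecursiveTreeWithClocks μ parent clock)
    (t : ℝ) {f : Measure ℝ → ℝ≥0∞} (hf : Measurable f) :
    ∫⁻ ω, f (logWeights parent clock t ω) ∂μ = ∫⁻ x, f (treeLogWeights t x) ∂treeLaw := by
  rw [← lintegral_map hf (h.measurable_logWeights t), h.map_logWeights,
    lintegral_map hf (measurable_treeLogWeights t)]

lemma measure_inter_preimage [IsProbabilityMeasure μ]
    (h : IsRecursiveTreeWithClocks μ parent clock) {s t : ℝ} (hs : 0 ≤ s) (ht : 0 ≤ t)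
    {A : Set (Measure ℝ)} (hA : MeasurableSet A) {B : Set Ω}
    (hB : MeasurableSet[pastSigma (logWeights parent clock) s] B) :
    μ (B ∩ logWeights parent clock (s + t) ⁻¹' A) =
      ∫⁻ ω in B, branchingKernel t (logWeights parent clock s ω) A ∂μ := by
  rw [pastSigma_logWeights] at hB
  obtain ⟨B, hB, rfl⟩ := hB
  have hBm : MeasurableSet B := pastSigma_le (fun r _ => measurable_treeLogWeights r) s B hB
  have hκ : Measurable fun x => branchingKernel t (treeLogWeights s x) A :=
    ((branchingKernel t).measurable_coe hA).comp (measurable_treeLogWeights s)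
  have h1 := treeLaw_inter_preimage hs ht hA hB
  rw [← h.map_markedTree, Measure.map_apply h.measurable_markedTree
    (hBm.inter (measurable_treeLogWeights (s + t) hA)),
    setLIntegral_map hBm hκ h.measurable_markedTree] at h1
  rw [logWeights_eq_comp, logWeights_eq_comp]
  exact h1

lemma condExp_logWeights [IsProbabilityMeasure μ] (h : IsRecursiveTreeWithClocks μ parent clock)
    {s t : ℝ} (hs : 0 ≤ s) (ht : 0 ≤ t) {A : Set (Measure ℝ)} (hA : MeasurableSet A) :
    μ[(logWeights parent clock (s + t) ⁻¹' A).indicator (fun _ => (1 : ℝ)) |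
      pastSigma (logWeights parent clock) s]
        =ᵐ[μ] fun ω => (branchingKernel t (logWeights parent clock s ω)).real A := by
  have hm := pastSigma_le (fun r _ => h.measurable_logWeights r) s
  have hA' : MeasurableSet (logWeights parent clock (s + t) ⁻¹' A) := h.measurable_logWeights _ hA
  have hκ : Measurable fun ω => branchingKernel t (logWeights parent clock s ω) A :=
    ((branchingKernel t).measurable_coe hA).comp (h.measurable_logWeights s)
  have hint : Integrable (fun ω => (branchingKernel t (logWeights parent clock s ω)).real A) μ :=
    Integrable.of_bound hκ.ennreal_toReal.aestronglyMeasurable 1 (ae_of_all _ fun ω => by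
      rw [Real.norm_of_nonneg measureReal_nonneg]
      exact measureReal_le_one)
  refine (ae_eq_condExp_of_forall_setIntegral_eq hm ((integrable_const _).indicator hA')
    (fun _ _ _ => hint.integrableOn) (fun B hB _ => ?_) ?_).symm
  · have hBm := hm B hB
    rw [setIntegral_indicator hA', setIntegral_const, smul_eq_mul, mul_one, measureReal_def,
      h.measure_inter_preimage hs ht hA hB]
    exact integral_toReal hκ.aemeasurable (ae_of_all _ fun ω => measure_lt_top _ _)
  · have hYs : Measurable[pastSigma (logWeights parent clock) s] (logWeights parent clock s) :=
      Measurable.mono (comap_measurable _) (le_iSup₂_of_le s ⟨hs, le_rfl⟩ le_rfl) le_rfl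
    exact (((branchingKernel t).measurable_coe hA).comp hYs).ennreal_toReal.stronglyMeasurable.aestronglyMeasurable

lemma ae_hasWeights [IsProbabilityMeasure μ] (h : IsRecursiveTreeWithClocks μ parent clock) {t : ℝ}
    (ht : 0 ≤ t) : ∀ᵐ ω ∂μ, ∀ C : (remainingForest parent clock t ω).ConnectedComponent,
      0 < blockWeight t C.supp ∧ Tendsto (scaledCount t C.supp) atTop (𝓝 (blockWeight t C.supp)) := by
  filter_upwards [h.ae_of_ae_treeLaw (ae_tendsto_rootWeight ht)] with ω hω C
  obtain ⟨b, rfl⟩ := (rootEquivComponent parent clock t ω).surjective C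
  rw [supp_rootEquivComponent]
  exact hω b b.2

lemma isBranching_logWeights [IsProbabilityMeasure μ]
    (h : IsRecursiveTreeWithClocks μ parent clock) :
    IsOUBranchingProcess μ (logWeights parent clock) where
  measurable t _ := h.measurable_logWeights t
  point_valued t ht := by
    filter_upwards [h.ae_of_ae_treeLaw (ae_finite_le_log_rootWeight ht)] with ω hω
    exact ⟨_, inferInstance, fun b : {b : ℕ // blockRoot t (markedTree parent clock ω) b = b} =>
      Real.log (rootWeight t (markedTree parent clock ω) b), hω,
      logWeights_eq_treeLogWeights parent clock t ω⟩
  transition t ht := by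
    refine ⟨branchingKernel t, inferInstance, fun ι _ y hy => ?_, fun s hs A hA =>
      h.condExp_logWeights hs ht hA⟩
    rw [h.map_logWeights]
    exact branchingKernel_pointMeasure hy t

end IsRecursiveTreeWithClocks

end

theorem theorem3 {Ω : Type*} [MeasurableSpace Ω] (μ : Measure Ω) [IsProbabilityMeasure μ]
    (parent : (k : ℕ) → Ω → Fin (k + 1)) (clock : ℕ → Ω → ℝ)
    (h : IsRecursiveTreeWithClocks μ parent clock) :
    -- at each time, almost surely, all the blocks have a weight, and it lies in `(0, ∞)`
    (∀ t : ℝ, 0 ≤ t → ∀ᵐ ω ∂μ,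
      ∀ C : (remainingForest parent clock t ω).ConnectedComponent,
        0 < blockWeight t C.supp ∧
        Tendsto (scaledCount t C.supp) atTop (𝓝 (blockWeight t C.supp))) ∧
    IsOUBranchingProcess μ (logWeights parent clock) ∧
    -- the formula for the mean intensity, and the fact that it determines the mean intensity
    (∀ t : ℝ, 0 ≤ t →
      (∀ q : ℝ, Real.exp t < q →
        ∫⁻ ω, ∫⁻ y, ENNReal.ofReal (Real.exp (q * y)) ∂(logWeights parent clock t ω) ∂μ =
          ENNReal.ofReal ((q - 1) / (Real.exp (-t) * q - 1) *
            (Real.Gamma q / Real.Gamma (Real.exp (-t) * q)))) ∧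
      ∀ m : Measure ℝ,
        (∀ q : ℝ, Real.exp t < q →
          ∫⁻ y, ENNReal.ofReal (Real.exp (q * y)) ∂m =
            ENNReal.ofReal ((q - 1) / (Real.exp (-t) * q - 1) *
              (Real.Gamma q / Real.Gamma (Real.exp (-t) * q)))) →
        ∀ B : Set ℝ, MeasurableSet B →
          m B = ∫⁻ ω, logWeights parent clock t ω B ∂μ) := by
  have hexp : ∀ t, 0 ≤ t → ∀ q, Real.exp t < q →
      ∫⁻ ω, ∫⁻ y, ENNReal.ofReal (Real.exp (q * y)) ∂(logWeights parent clock t ω) ∂μ =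
        ENNReal.ofReal ((q - 1) / (Real.exp (-t) * q - 1) *
          (Real.Gamma q / Real.Gamma (Real.exp (-t) * q))) := fun t ht q hq => by
    rw [h.lintegral_logWeights t (f := fun m => ∫⁻ y, ENNReal.ofReal (Real.exp (q * y)) ∂m)
      (Measure.measurable_lintegral (by fun_prop)), lintegral_exp_treeLogWeights ht hq]
  refine ⟨fun t ht => h.ae_hasWeights ht, h.isBranching_logWeights, fun t ht =>
    ⟨hexp t ht, fun m hm B hB => ?_⟩⟩
  have hbind : m = μ.bind (logWeights parent clock t) := by
    refine measure_ext_of_lintegral_exp (a := Real.exp t)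
      (fun q hq => by rw [hm q hq]; exact ENNReal.ofReal_ne_top) fun q hq => ?_
    rw [hm q hq, Measure.lintegral_bind (h.measurable_logWeights t).aemeasurable (by fun_prop),
      hexp t ht q hq]
  rw [hbind, Measure.bind_apply hB (h.measurable_logWeights t).aemeasurable]
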